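/- **Setting.** Consider the discrete-time LTI plant $$x[t+1]=Ax[t]+B_1w[t]+B_2u[t],\quad z[t]=C_1x[t]+D_{11}w[t]+D_{12}u[t],\quad y[t]=C_2x[t]+D_{21}w[t]+D_{22}u[t],$$ with real matrices, $(A,B_2)$ stabilizable and $(A,C_2)$ detectable, and let $\mathbf P_{ij}=C_i(zI-A)^{-1}B_j+D_{ij}$. Let $\mathcal{RH}_\infty$ denote the real-rational proper transfer matrices all of whose poles lie in the open unit disc. Let $\mathcal C_{\rm stab}$ be the set of transfer matrices $\mathbf K=C_k(zI-A_k)^{-1}B_k+D_k$ of controllers $\xi[t+1]=A_k\xi[t]+B_ky[t]$, $u[t]=C_k\xi[t]+D_ky[t]$, with $(A_k,B_k)$ stabilizable and $(A_k,C_k)$ detectable, that internally stabilize the plant: $I-D_{22}D_k$ is invertible and, for $w=0$, $x[t]\to0$ and $\xi[t]\to 0$ for all initial states. Write $f(\mathbf P,\mathbf K)=\mathbf P_{11}+\mathbf P_{12}\mathbf K(I-\mathbf P_{22}\mathbf K)^{-1}\mathbf P_{21}$. Call $(\mathbf Y,\mathbf U,\mathbf W,\mathbf Z)$ an element of the *IOP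 affine subspace* if $$\begin{bmatrix}I&-\mathbf P_{22}\end{bmatrix}\begin{bmatrix}\mathbf Y&\mathbf W\\ \mathbf U&\mathbf Z\end{bmatrix}=\begin{bmatrix}I&0\end{bmatrix},\qquad \begin{bmatrix}\mathbf Y&\mathbf W\\ \mathbf U&\mathbf Z\end{bmatrix}\begin{bmatrix}-\mathbf P_{22}\\ I\end{bmatrix}=\begin{bmatrix}0\\ I\end{bmatrix},\qquad \mathbf Y,\mathbf U,\mathbf W,\mathbf Z\in\mathcal{RH}_\infty .$$ Let $\mathcal L$ be a real linear subspace of transfer matrices of the size of $\mathbf K$ that is closed in the following sense: a proper $\mathbf K$ belongs to $\mathcal L$ whenever for every $N$ some $\mathbf K'\in\mathcal L$ is such that $z^{N}(\mathbf K-\mathbf K')$ is proper (that is, the proper part of $\mathcal L$ is closed under coefficientwise convergence of impulse responses). Suppose that $\mathcal L$ is quadratically invariant under $\mathbf P_{22}$: $\mathbf K\mathbf P_{22}\mathbf K\in\mathcal L$ for all $\mathbf K\in\mathcal L$. Let $\Phi$ be the set of elements $(\mathbf Y,\mathbf U,\mathbf W,\mathbf Z)$ of the IOP affine subspace with $\mathbf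 U\in\mathcal L$, and say that such an element *defines a controller* if $\mathbf Y$ is invertible and $\mathbf U\mathbf Y^{-1}$ is proper. **Claim.** 1. $\mathcal C_{\rm stab}\cap\mathcal L=\{\mathbf K=\mathbf U\mathbf Y^{-1}\mid(\mathbf Y,\mathbf U,\mathbf W,\mathbf Z)\in\Phi \text{ defines a controller}\}$. If $D_{22}=0$, every element of $\Phi$ defines a controller. 2. The problem of minimizing $\|f(\mathbf P,\mathbf K)\|$ over $\mathbf K\in\mathcal C_{\rm stab}\cap\mathcal L$ is equivalent to the convex problem of minimizing $\|\mathbf P_{11}+\mathbf P_{12}\mathbf U\mathbf P_{21}\|$ over $\Phi$. Precisely: $\mathbf P_{11}+\mathbf P_{12}\mathbf U\mathbf P_{21}\in\mathcal{RH}_\infty$ on $\Phi$; the map $(\mathbf Y,\mathbf U,\mathbf W,\mathbf Z)\mapsto\mathbf U\mathbf Y^{-1}$ is a bijection from the elements of $\Phi$ that define a controller onto $\mathcal C_{\rm stab}\cap\mathcal L$, and $f(\mathbf P,\mathbf U\mathbf Y^{-1})=\mathbf P_{11}+\mathbf P_{12}\mathbf U\mathbf P_{21}$ for them; and for every norm (indeed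 every seminorm) $\|\cdot\|$ on $\mathcal{RH}_\infty$, - the set $\Phi$ is convex, and $\|\mathbf P_{11}+\mathbf P_{12}\mathbf U\mathbf P_{21}\|$ is a convex function on $\Phi$; - if $D_{22}=0$ or $\mathcal C_{\rm stab}\cap\mathcal L\neq\emptyset$, the two problems have the same infimum (with value $+\infty$ for an infeasible problem); - $\mathbf K$ is a minimizer of the first problem if and only if $\mathbf K=\mathbf U\mathbf Y^{-1}$ for a minimizer $(\mathbf Y,\mathbf U,\mathbf W,\mathbf Z)$ of the second that defines a controller. -/

import Mathlib

open scoped Topology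

noncomputable section

/-- Transfer matrices: matrices of real rational functions in the variable `z = RatFunc.X`. -/
abbrev TransferMatrix (p m : ℕ) : Type := Matrix (Fin p) (Fin m) (RatFunc ℝ)

/-- A real matrix regarded as a (static) transfer matrix. -/
def constTM {p m : ℕ} (M : Matrix (Fin p) (Fin m) ℝ) : TransferMatrix p m :=
  M.map (RatFunc.C : ℝ →+* RatFunc ℝ)

/-- The transfer matrix `C (zI - A)⁻¹ B + D` of the state-space realization `(A, B, C, D)`. -/
def transfer {n p m : ℕ} (A : Matrix (Fin n) (Fin n) ℝ) (B : Matrix (Fin n) (Fin m) ℝ)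
    (C : Matrix (Fin p) (Fin n) ℝ) (D : Matrix (Fin p) (Fin m) ℝ) : TransferMatrix p m :=
  constTM C * (Matrix.scalar (Fin n) (RatFunc.X : RatFunc ℝ) - constTM A)⁻¹ * constTM B +
    constTM D

/-- Properness: in every entry the degree of the numerator is at most that of the denominator. -/
def IsProperTM {p m : ℕ} (G : TransferMatrix p m) : Prop :=
  ∀ i j, (G i j).intDegree ≤ 0

/-- Stability (discrete time): all poles of all entries lie in the open unit disc. -/
def IsStableTM {p m : ℕ} (G : TransferMatrix p m) : Prop :=
  ∀ i j, ∀ a : ℂ, Polynomial.aeval a (G i j).denom = 0 → ‖a‖ < 1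

/-- The set `RH∞` of real-rational proper stable transfer matrices. -/
def RHinf (p m : ℕ) : Set (TransferMatrix p m) :=
  {G | IsProperTM G ∧ IsStableTM G}

/-- All (complex) eigenvalues of the real matrix `A` lie in the open unit disc. -/
def IsSchur {n : ℕ} (A : Matrix (Fin n) (Fin n) ℝ) : Prop :=
  ∀ a ∈ spectrum ℂ (A.map (algebraMap ℝ ℂ)), ‖a‖ < 1

/-- `(A, B)` is stabilizable. -/
def Stabilizable {n m : ℕ} (A : Matrix (Fin n) (Fin n) ℝ) (B : Matrix (Fin n) (Fin m) ℝ) : Prop :=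
  ∃ F : Matrix (Fin m) (Fin n) ℝ, IsSchur (A + B * F)

/-- `(A, C)` is detectable. -/
def Detectable {n p : ℕ} (A : Matrix (Fin n) (Fin n) ℝ) (C : Matrix (Fin p) (Fin n) ℝ) : Prop :=
  ∃ H : Matrix (Fin n) (Fin p) ℝ, IsSchur (A + H * C)

/-- State-space data of the plant
`x⁺ = A x + B₁ w + B₂ u`, `z = C₁ x + D₁₁ w + D₁₂ u`, `y = C₂ x + D₂₁ w + D₂₂ u`. -/
structure Plant (n nw nu nz ny : ℕ) where
  A : Matrix (Fin n) (Fin n) ℝ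
  B₁ : Matrix (Fin n) (Fin nw) ℝ
  B₂ : Matrix (Fin n) (Fin nu) ℝ
  C₁ : Matrix (Fin nz) (Fin n) ℝ
  C₂ : Matrix (Fin ny) (Fin n) ℝ
  D₁₁ : Matrix (Fin nz) (Fin nw) ℝ
  D₁₂ : Matrix (Fin nz) (Fin nu) ℝ
  D₂₁ : Matrix (Fin ny) (Fin nw) ℝ
  D₂₂ : Matrix (Fin ny) (Fin nu) ℝ

/-- State-space data of a controller `ξ⁺ = A ξ + B y`, `u = C ξ + D y` of order `k`. -/
structure Controller (k nu ny : ℕ) where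
  A : Matrix (Fin k) (Fin k) ℝ
  B : Matrix (Fin k) (Fin ny) ℝ
  C : Matrix (Fin nu) (Fin k) ℝ
  D : Matrix (Fin nu) (Fin ny) ℝ

namespace Plant

variable {n nw nu nz ny : ℕ} (P : Plant n nw nu nz ny)

def P₁₁ : TransferMatrix nz nw := transfer P.A P.B₁ P.C₁ P.D₁₁
def P₁₂ : TransferMatrix nz nu := transfer P.A P.B₂ P.C₁ P.D₁₂
def P₂₁ : TransferMatrix ny nw := transfer P.A P.B₁ P.C₂ P.D₂₁
def P₂₂ : TransferMatrix ny nu := transfer P.A P.B₂ P.C₂ P.D₂₂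

/-- The signals `x, ξ, u, y` form a trajectory of the interconnection with zero disturbance
`w = 0`. -/
def IsTrajectory {k : ℕ} (κ : Controller k nu ny) (x : ℕ → Fin n → ℝ) (ξ : ℕ → Fin k → ℝ)
    (u : ℕ → Fin nu → ℝ) (y : ℕ → Fin ny → ℝ) : Prop :=
  ∀ t,
    x (t + 1) = P.A.mulVec (x t) + P.B₂.mulVec (u t) ∧
    y t = P.C₂.mulVec (x t) + P.D₂₂.mulVec (u t) ∧
    ξ (t + 1) = κ.A.mulVec (ξ t) + κ.B.mulVec (y t) ∧
    u t = κ.C.mulVec (ξ t) + κ.D.mulVec (y t)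

/-- Internal stability: the loop is well-posed, and for `w = 0` the plant and controller states
converge to zero from every initial condition. -/
def InternallyStable {k : ℕ} (κ : Controller k nu ny) : Prop :=
  IsUnit (1 - P.D₂₂ * κ.D) ∧
    ∀ x ξ u y, P.IsTrajectory κ x ξ u y →
      Filter.Tendsto x Filter.atTop (𝓝 0) ∧ Filter.Tendsto ξ Filter.atTop (𝓝 0)

/-- `C_stab`: the transfer matrices of the internally stabilizing controllers, where controller
realizations are stabilizable and detectable. -/
def Cstab : Set (TransferMatrix nu ny) :=
  {K | ∃ (k : ℕ) (κ : Controller k nu ny),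
    Stabilizable κ.A κ.B ∧ Detectable κ.A κ.C ∧
    K = transfer κ.A κ.B κ.C κ.D ∧ P.InternallyStable κ}

/-- The closed-loop map `f(P, K) = P₁₁ + P₁₂ K (I - P₂₂ K)⁻¹ P₂₁` from `w` to `z`. -/
def closedLoop (K : TransferMatrix nu ny) : TransferMatrix nz nw :=
  P.P₁₁ + P.P₁₂ * K * (1 - P.P₂₂ * K)⁻¹ * P.P₂₁

end Plant

/-- Quadruples `(Y, U, W, Z)` of input-output parameters. -/
abbrev IOParam (nu ny : ℕ) : Type :=
  TransferMatrix ny ny × TransferMatrix nu ny × TransferMatrix ny nu × TransferMatrix nu nu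

namespace IOParam

variable {nu ny : ℕ} (q : IOParam nu ny)

def Y : TransferMatrix ny ny := q.1
def U : TransferMatrix nu ny := q.2.1
def W : TransferMatrix ny nu := q.2.2.1
def Z : TransferMatrix nu nu := q.2.2.2

/-- The transfer matrix `U Y⁻¹`. -/
def controller : TransferMatrix nu ny := IOParam.U q * (IOParam.Y q)⁻¹

/-- `U Y⁻¹` makes sense as a controller: `Y` is invertible (so that `⁻¹` is a true inverse) and
`U Y⁻¹` is proper (so that it has a state-space realization). -/
def DefinesController : Prop :=
  IsUnit (IOParam.Y q) ∧ IsProperTM (IOParam.controller q)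

end IOParam

namespace Plant

variable {n nw nu nz ny : ℕ} (P : Plant n nw nu nz ny)

/-- The affine subspace of the input-output parameterization. -/
def iopSubspace : Set (IOParam nu ny) :=
  {q |
    Matrix.fromCols (1 : TransferMatrix ny ny) (-P.P₂₂) *
        Matrix.fromBlocks (IOParam.Y q) (IOParam.W q) (IOParam.U q) (IOParam.Z q) =
      Matrix.fromCols (1 : TransferMatrix ny ny) (0 : TransferMatrix ny nu) ∧
    Matrix.fromBlocks (IOParam.Y q) (IOParam.W q) (IOParam.U q) (IOParam.Z q) *
        Matrix.fromRows (-P.P₂₂) (1 : TransferMatrix nu nu) =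
      Matrix.fromRows (0 : TransferMatrix ny nu) (1 : TransferMatrix nu nu) ∧
    IOParam.Y q ∈ RHinf ny ny ∧ IOParam.U q ∈ RHinf nu ny ∧
    IOParam.W q ∈ RHinf ny nu ∧ IOParam.Z q ∈ RHinf nu nu}

/-- The feasible set of the structured input-output problem: the affine subspace together with
`U ∈ L`. -/
def iopFeasible (L : Submodule ℝ (TransferMatrix nu ny)) : Set (IOParam nu ny) :=
  {q | q ∈ P.iopSubspace ∧ IOParam.U q ∈ L}

/-- `P₁₁ + P₁₂ U P₂₁`, the closed-loop map in terms of input-output parameters. -/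
def iopClosedLoop (q : IOParam nu ny) : TransferMatrix nz nw :=
  P.P₁₁ + P.P₁₂ * IOParam.U q * P.P₂₁

end Plant

/-- `L` is quadratically invariant under `G`. -/
def QuadraticallyInvariant {nu ny : ℕ} (L : Submodule ℝ (TransferMatrix nu ny))
    (G : TransferMatrix ny nu) : Prop :=
  ∀ K ∈ L, K * G * K ∈ L

/-- `L` is closed, among proper transfer matrices, for coefficientwise convergence of impulse
responses (the expansions in powers of `z⁻¹`): a proper `K` is in `L` as soon as, for each `N`,
some element of `L` has the same impulse response as `K` at the times `0, …, N - 1`, that is,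
differs from `K` by `z⁻ᴺ` times a proper transfer matrix.
Since the truncations of a linear subspace to finitely many times are finite-dimensional, hence
closed, these `K` are exactly the coefficientwise limits of proper elements of `L`. -/
def IsResponseClosed {nu ny : ℕ} (L : Submodule ℝ (TransferMatrix nu ny)) : Prop :=
  ∀ K, IsProperTM K →
    (∀ N : ℕ, ∃ K' ∈ L, IsProperTM ((RatFunc.X : RatFunc ℝ) ^ N • (K - K'))) → K ∈ L

/-- `ν` restricts to a seminorm on the real vector space `RH∞` (for instance the `H₂` or the `H∞`
norm); its values elsewhere are irrelevant. -/
structure IsSeminormOnRHinf {p m : ℕ} (ν : TransferMatrix p m → ℝ) : Prop where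
  add_le : ∀ S ∈ RHinf p m, ∀ T ∈ RHinf p m, ν (S + T) ≤ ν S + ν T
  smul : ∀ (c : ℝ), ∀ S ∈ RHinf p m, ν (c • S) = |c| * ν S

end

/-! The inverse of the loop matrix `[I, -P₂₂; -K, I]` has the blocks `Y = (I - P₂₂ K)⁻¹`, `W = Y
P₂₂`, `U = K Y`, `Z = I + U P₂₂`, so the affine equations say that `(Y, W; U, Z)` is such an
inverse. The theorem rests on three facts.

Stability. For a stabilizing `K`, the inverse has a state-space formula (`one_sub_realize_mul`)
whose state matrix is that of the closed loop, hence Schur (`schurStable_closedLoop`). Conversely,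
stability of the four blocks extends to the maps through the plant state by stabilizability and
detectability (`entriesIn_state_maps`). This makes a Youla-type parameter `Q` stable, and the
observer-based controller with parameter `Q` internally stabilizes the plant and has transfer matrix
`U Y⁻¹` (`controller_mem_Cstab`).

Structure. `K ↦ K (I - G K)⁻¹` maps proper elements of `L` into `L`, for proper `G` and a proper
inverse: the inverse is approximated at infinity by polynomials in `I - G K`, and quadratic
invariance keeps `K` times such a polynomial in `L` (`QuadraticallyInvariant.mul_inv_mem`). With `G
= P₂₂` this takes `K` to `U`; with `G = -P₂₂` it takes `U` back to `U Y⁻¹`.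

Optimization. An element of the affine subspace defines a controller exactly when `Y` is invertible
at infinity. On a line through one such element this fails at finitely many points only, so by
convexity any cost bound attained strictly on `Φ` is also attained strictly by an element that
defines a controller (`exists_definesController_lt`). -/

noncomputable section

/-! ### Stable and proper scalar rational functions, and evaluation at infinity. -/

open Polynomial in
/-- A quotient of polynomials is stable if the roots of the denominator lie in the open unit
disc. -/
theorem stable_div {p q : ℝ[X]} (hq : ∀ a : ℂ, aeval a q = 0 → ‖a‖ < 1) (a : ℂ)
    (ha : aeval a (algebraMap ℝ[X] (RatFunc ℝ) p / algebraMap ℝ[X] (RatFunc ℝ) q).denom = 0) :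
    ‖a‖ < 1 := by
  obtain ⟨r, hr⟩ := RatFunc.denom_div_dvd (K := ℝ) p q
  apply hq
  rw [hr, map_mul, ha, zero_mul]

open Polynomial in
theorem stable_of_denom_dvd {f g h : RatFunc ℝ} (hd : h.denom ∣ f.denom * g.denom)
    (hf : ∀ a : ℂ, aeval a f.denom = 0 → ‖a‖ < 1) (hg : ∀ a : ℂ, aeval a g.denom = 0 → ‖a‖ < 1)
    (a : ℂ) (ha : aeval a h.denom = 0) : ‖a‖ < 1 := by
  obtain ⟨r, hr⟩ := hd
  have h0 : aeval a (f.denom * g.denom) = 0 := by rw [hr, map_mul, ha, zero_mul]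
  rw [map_mul, mul_eq_zero] at h0
  exact h0.elim (hf a) (hg a)

/-- The algebra of stable rational functions. -/
def stableAlg : Subalgebra ℝ (RatFunc ℝ) where
  carrier := {f | ∀ a : ℂ, Polynomial.aeval a f.denom = 0 → ‖a‖ < 1}
  mul_mem' {f g} hf hg := stable_of_denom_dvd (RatFunc.denom_mul_dvd f g) hf hg
  add_mem' {f g} hf hg := stable_of_denom_dvd (RatFunc.denom_add_dvd f g) hf hg
  algebraMap_mem' c := by simp [RatFunc.algebraMap_eq_C]

/-- The algebra of proper rational functions. -/
def properAlg : Subalgebra ℝ (RatFunc ℝ) where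
  carrier := {f | f.intDegree ≤ 0}
  mul_mem' {f g} hf hg := by
    change f.intDegree ≤ 0 at hf
    change g.intDegree ≤ 0 at hg
    change (f * g).intDegree ≤ 0
    by_cases h0 : f = 0
    · simp [h0]
    by_cases h1 : g = 0
    · simp [h1]
    rw [RatFunc.intDegree_mul h0 h1]
    omega
  add_mem' {f g} hf hg := by
    by_cases h1 : g = 0
    · simpa [h1] using hf
    by_cases h2 : f + g = 0
    · simp [h2]
    exact (RatFunc.intDegree_add_le h1 h2).trans (max_le hf hg)
  algebraMap_mem' c := by simp [RatFunc.algebraMap_eq_C]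

/-- The algebra of proper stable rational functions. -/
def rhAlg : Subalgebra ℝ (RatFunc ℝ) := properAlg ⊓ stableAlg

theorem mem_properAlg {f : RatFunc ℝ} : f ∈ properAlg ↔ f.intDegree ≤ 0 := Iff.rfl

theorem mem_stableAlg {f : RatFunc ℝ} :
    f ∈ stableAlg ↔ ∀ a : ℂ, Polynomial.aeval a f.denom = 0 → ‖a‖ < 1 := Iff.rfl

theorem C_mem (R : Subalgebra ℝ (RatFunc ℝ)) (c : ℝ) : RatFunc.C c ∈ R := by
  rw [← RatFunc.algebraMap_eq_C]
  exact R.algebraMap_mem c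

theorem inv_X_mem_properAlg : (RatFunc.X : RatFunc ℝ)⁻¹ ∈ properAlg := by
  simp [mem_properAlg]

-- Since `intDegree 0 = 0`, a zero numerator satisfies the bound only when `0 ≤ k`; this is what
-- `hk` supplies.
open Polynomial in
theorem intDegree_div_le {p q : ℝ[X]} {k : ℤ} (hq : q ≠ 0) (hk : p = 0 → 0 ≤ k)
    (h : (p.natDegree : ℤ) ≤ q.natDegree + k) :
    (algebraMap ℝ[X] (RatFunc ℝ) p / algebraMap ℝ[X] (RatFunc ℝ) q).intDegree ≤ k := by
  by_cases hp : p = 0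
  · simpa [hp] using hk hp
  have hp' : algebraMap ℝ[X] (RatFunc ℝ) p ≠ 0 := by simpa using hp
  have hq' : algebraMap ℝ[X] (RatFunc ℝ) q ≠ 0 := by simpa using hq
  rw [RatFunc.intDegree_div hp' hq', RatFunc.intDegree_polynomial, RatFunc.intDegree_polynomial]
  omega

theorem mem_properAlg_of_X_mul {f : RatFunc ℝ} (h : RatFunc.X * f ∈ properAlg) :
    f ∈ properAlg := by
  have := properAlg.mul_mem inv_X_mem_properAlg h
  rwa [← mul_assoc, inv_mul_cancel₀ RatFunc.X_ne_zero, one_mul] at this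

open Polynomial in
/-- A proper rational function has a value at infinity. -/
theorem exists_feedthrough {f : RatFunc ℝ} (hf : f ∈ properAlg) :
    ∃ c : ℝ, RatFunc.X * (f - RatFunc.C c) ∈ properAlg := by
  have hd : f.denom ≠ 0 := f.denom_ne_zero
  have hm : f.denom.Monic := f.monic_denom
  have hdeg : f.num.natDegree ≤ f.denom.natDegree := by
    have : (f.num.natDegree : ℤ) - f.denom.natDegree ≤ 0 := hf
    omega
  -- The denominator is monic, so this coefficient is the ratio of the terms of top degree, and it
  -- is zero when `f` is strictly proper.
  refine ⟨f.num.coeff f.denom.natDegree, ?_⟩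
  set c := f.num.coeff f.denom.natDegree
  have hd' : algebraMap ℝ[X] (RatFunc ℝ) f.denom ≠ 0 := by simpa using hd
  have hE : RatFunc.X * (f - RatFunc.C c) =
      algebraMap ℝ[X] (RatFunc ℝ) (X * (f.num - C c * f.denom)) /
        algebraMap ℝ[X] (RatFunc ℝ) f.denom := by
    conv_lhs => rw [← RatFunc.num_div_denom f]
    rw [map_mul, map_sub, map_mul, RatFunc.algebraMap_X, RatFunc.algebraMap_C]
    field_simp
  rw [hE, mem_properAlg]
  refine intDegree_div_le hd (fun _ => le_rfl) ?_
  rw [add_zero, Nat.cast_le]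
  have hcoef : (f.num - C c * f.denom).coeff f.denom.natDegree = 0 := by
    simp [c, hm.coeff_natDegree]
  have hle : (f.num - C c * f.denom).natDegree ≤ f.denom.natDegree :=
    (natDegree_sub_le _ _).trans (max_le hdeg (natDegree_C_mul_le _ _))
  by_cases h0 : f.num - C c * f.denom = 0
  · simp [h0]
  have hlt : (f.num - C c * f.denom).natDegree < f.denom.natDegree := by
    refine lt_of_le_of_ne hle fun h => h0 ?_
    rw [← leadingCoeff_eq_zero, leadingCoeff, h, hcoef]
  rw [natDegree_X_mul h0]
  omega

/-- The difference of the two proper functions is `X` times a constant, which has degree one unless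
the constant vanishes. -/
theorem feedthrough_unique {f : RatFunc ℝ} {c c' : ℝ}
    (h : RatFunc.X * (f - RatFunc.C c) ∈ properAlg)
    (h' : RatFunc.X * (f - RatFunc.C c') ∈ properAlg) : c = c' := by
  have h1 := properAlg.sub_mem h' h
  have h2 : RatFunc.X * (f - RatFunc.C c') - RatFunc.X * (f - RatFunc.C c) =
      RatFunc.X * RatFunc.C (c - c') := by
    rw [map_sub]; ring
  rw [h2] at h1
  by_contra hne
  have h3 : (RatFunc.C (c - c') : RatFunc ℝ) ≠ 0 := by
    rw [map_ne_zero]; exact sub_ne_zero.mpr hne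
  rw [mem_properAlg, RatFunc.intDegree_mul RatFunc.X_ne_zero h3, RatFunc.intDegree_X,
    RatFunc.intDegree_C] at h1
  omega

/-- The value at infinity of a proper rational function. -/
def feedthroughFun (f : properAlg) : ℝ := (exists_feedthrough f.2).choose

theorem feedthroughFun_spec (f : properAlg) :
    RatFunc.X * ((f : RatFunc ℝ) - RatFunc.C (feedthroughFun f)) ∈ properAlg :=
  (exists_feedthrough f.2).choose_spec

theorem feedthroughFun_eq {f : properAlg} {c : ℝ}
    (h : RatFunc.X * ((f : RatFunc ℝ) - RatFunc.C c) ∈ properAlg) : feedthroughFun f = c :=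
  feedthrough_unique (feedthroughFun_spec f) h

theorem feedthroughFun_algebraMap (c : ℝ) : feedthroughFun (algebraMap ℝ properAlg c) = c := by
  apply feedthroughFun_eq
  have : ((algebraMap ℝ properAlg c : properAlg) : RatFunc ℝ) = RatFunc.C c := by
    rw [← RatFunc.algebraMap_eq_C]; rfl
  rw [this, sub_self, mul_zero]
  exact properAlg.zero_mem

/-- Evaluation at infinity, as a homomorphism of algebras. -/
def feedthrough : properAlg →ₐ[ℝ] ℝ where
  toFun := feedthroughFun
  map_one' := by simpa using feedthroughFun_algebraMap 1
  map_zero' := by simpa using feedthroughFun_algebraMap 0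
  map_add' f g := by
    apply feedthroughFun_eq
    have := properAlg.add_mem (feedthroughFun_spec f) (feedthroughFun_spec g)
    convert this using 1
    push_cast
    rw [map_add]; ring
  map_mul' f g := by
    apply feedthroughFun_eq
    have := properAlg.add_mem (properAlg.mul_mem (feedthroughFun_spec f) g.2)
      (properAlg.mul_mem (C_mem _ (feedthroughFun f)) (feedthroughFun_spec g))
    convert this using 1
    push_cast
    rw [map_mul]; ring
  commutes' := feedthroughFun_algebraMap

theorem feedthrough_eq {f : properAlg} {c : ℝ}
    (h : RatFunc.X * ((f : RatFunc ℝ) - RatFunc.C c) ∈ properAlg) : feedthrough f = c :=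
  feedthroughFun_eq h

theorem feedthrough_spec (f : properAlg) :
    RatFunc.X * ((f : RatFunc ℝ) - RatFunc.C (feedthrough f)) ∈ properAlg :=
  feedthroughFun_spec f

/-- A proper rational function with nonzero value at infinity is a unit of `properAlg`. -/
theorem isUnit_of_feedthrough_ne_zero {f : properAlg} (h : feedthrough f ≠ 0) : IsUnit f := by
  have h0 : (f : RatFunc ℝ) ≠ 0 := by
    intro h0
    apply h
    have : f = 0 := Subtype.ext h0
    rw [this, map_zero]
  have hdeg : (f : RatFunc ℝ).intDegree = 0 := by
    refine le_antisymm f.2 ?_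
    by_contra hlt
    apply h
    apply feedthrough_eq
    rw [map_zero, sub_zero, mem_properAlg, RatFunc.intDegree_mul RatFunc.X_ne_zero h0]
    simp only [RatFunc.intDegree_X]
    omega
  refine IsUnit.of_mul_eq_one ⟨(f : RatFunc ℝ)⁻¹, ?_⟩ ?_
  · rw [mem_properAlg, RatFunc.intDegree_inv, hdeg, neg_zero]
  · exact Subtype.ext (mul_inv_cancel₀ h0)

/-! ### Matrices with entries in a subalgebra, and their values at infinity. -/

section Entries

variable {α β γ δ : Type*} {R : Subalgebra ℝ (RatFunc ℝ)}

/-- A real matrix with arbitrary index types, as a static transfer matrix. -/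
def toTM (M : Matrix α β ℝ) : Matrix α β (RatFunc ℝ) := M.map (RatFunc.C : ℝ →+* RatFunc ℝ)

@[simp] theorem toTM_add (M N : Matrix α β ℝ) : toTM (M + N) = toTM M + toTM N := by
  ext; simp [toTM]

@[simp] theorem toTM_sub (M N : Matrix α β ℝ) : toTM (M - N) = toTM M - toTM N := by
  ext; simp [toTM]

@[simp] theorem toTM_neg (M : Matrix α β ℝ) : toTM (-M) = -toTM M := by
  ext; simp [toTM]

@[simp] theorem toTM_zero : toTM (0 : Matrix α β ℝ) = 0 := by
  ext; simp [toTM]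

@[simp] theorem toTM_one [DecidableEq α] : toTM (1 : Matrix α α ℝ) = 1 := by
  simp [toTM]

@[simp] theorem toTM_mul [Fintype β] (M : Matrix α β ℝ) (N : Matrix β γ ℝ) :
    toTM (M * N) = toTM M * toTM N := by
  simp [toTM, Matrix.map_mul]

theorem toTM_fromBlocks (M : Matrix α γ ℝ) (N : Matrix α δ ℝ) (M' : Matrix β γ ℝ)
    (N' : Matrix β δ ℝ) : toTM (Matrix.fromBlocks M N M' N') =
      Matrix.fromBlocks (toTM M) (toTM N) (toTM M') (toTM N') :=
  Matrix.fromBlocks_map _ _ _ _ _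

theorem toTM_fromCols (M : Matrix α γ ℝ) (N : Matrix α δ ℝ) :
    toTM (Matrix.fromCols M N) = Matrix.fromCols (toTM M) (toTM N) := by
  ext i (j | j) <;> rfl

theorem toTM_fromRows (M : Matrix α γ ℝ) (N : Matrix β γ ℝ) :
    toTM (Matrix.fromRows M N) = Matrix.fromRows (toTM M) (toTM N) := by
  ext (i | i) j <;> rfl

/-- All entries of a matrix of rational functions belong to `R`. -/
def EntriesIn (R : Subalgebra ℝ (RatFunc ℝ)) (G : Matrix α β (RatFunc ℝ)) : Prop :=
  ∀ i j, G i j ∈ R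

namespace EntriesIn

variable {G H : Matrix α β (RatFunc ℝ)}

theorem add (hG : EntriesIn R G) (hH : EntriesIn R H) : EntriesIn R (G + H) :=
  fun i j => R.add_mem (hG i j) (hH i j)

theorem sub (hG : EntriesIn R G) (hH : EntriesIn R H) : EntriesIn R (G - H) :=
  fun i j => R.sub_mem (hG i j) (hH i j)

theorem neg (hG : EntriesIn R G) : EntriesIn R (-G) :=
  fun i j => R.neg_mem (hG i j)

theorem smul_real (c : ℝ) (hG : EntriesIn R G) : EntriesIn R (c • G) :=
  fun i j => R.smul_mem (hG i j) c

theorem mul [Fintype β] {H : Matrix β γ (RatFunc ℝ)} (hG : EntriesIn R G) (hH : EntriesIn R H) :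
    EntriesIn R (G * H) :=
  fun i j => R.sum_mem fun k _ => R.mul_mem (hG i k) (hH k j)

theorem zero : EntriesIn R (0 : Matrix α β (RatFunc ℝ)) := fun _ _ => R.zero_mem

theorem const (M : Matrix α β ℝ) : EntriesIn R (toTM M) := fun _ _ => C_mem R _

theorem one [DecidableEq α] : EntriesIn R (1 : Matrix α α (RatFunc ℝ)) := by
  rw [← toTM_one]; exact const 1

theorem pow [Fintype α] [DecidableEq α] {G : Matrix α α (RatFunc ℝ)} (hG : EntriesIn R G) (k : ℕ) :
    EntriesIn R (G ^ k) := by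
  induction k with
  | zero => rw [pow_zero]; exact one
  | succ k ih => rw [pow_succ]; exact ih.mul hG

theorem mono {R' : Subalgebra ℝ (RatFunc ℝ)} (h : R ≤ R') (hG : EntriesIn R G) : EntriesIn R' G :=
  fun i j => h (hG i j)

end EntriesIn

theorem mem_RHinf_iff {p m : ℕ} {G : TransferMatrix p m} : G ∈ RHinf p m ↔ EntriesIn rhAlg G :=
  ⟨fun h i j => ⟨h.1 i j, h.2 i j⟩, fun h => ⟨fun i j => (h i j).1, fun i j => (h i j).2⟩⟩

/-- `G` is proper, with value `D` at infinity. -/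
def HasFeedthrough (G : Matrix α β (RatFunc ℝ)) (D : Matrix α β ℝ) : Prop :=
  ∃ G' : Matrix α β properAlg, G'.map properAlg.val = G ∧ G'.map feedthrough = D

namespace HasFeedthrough

theorem proper {G : Matrix α β (RatFunc ℝ)} {D : Matrix α β ℝ} (h : HasFeedthrough G D) :
    EntriesIn properAlg G := by
  obtain ⟨G', rfl, -⟩ := h
  exact fun i j => (G' i j).2

theorem of_X_smul {G : Matrix α β (RatFunc ℝ)} {D : Matrix α β ℝ}
    (h : EntriesIn properAlg ((RatFunc.X : RatFunc ℝ) • (G - toTM D))) : HasFeedthrough G D := by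
  have hG : EntriesIn properAlg G := by
    intro i j
    have h1 := mem_properAlg_of_X_mul (h i j)
    have h2 := properAlg.add_mem h1 (C_mem properAlg (D i j))
    simpa [toTM] using h2
  refine ⟨fun i j => ⟨G i j, hG i j⟩, rfl, ?_⟩
  ext i j
  exact feedthrough_eq (h i j)

theorem X_smul {G : Matrix α β (RatFunc ℝ)} {D : Matrix α β ℝ} (h : HasFeedthrough G D) :
    EntriesIn properAlg ((RatFunc.X : RatFunc ℝ) • (G - toTM D)) := by
  obtain ⟨G', rfl, rfl⟩ := h
  exact fun i j => feedthrough_spec (G' i j)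

theorem const (D : Matrix α β ℝ) : HasFeedthrough (toTM D) D := by
  apply of_X_smul
  rw [sub_self, smul_zero]
  exact EntriesIn.zero

theorem one [DecidableEq α] : HasFeedthrough (1 : Matrix α α (RatFunc ℝ)) 1 := by
  simpa using const (1 : Matrix α α ℝ)

theorem unique {G : Matrix α β (RatFunc ℝ)} {D D' : Matrix α β ℝ}
    (h : HasFeedthrough G D) (h' : HasFeedthrough G D') : D = D' := by
  ext i j
  exact feedthrough_unique (h.X_smul i j) (h'.X_smul i j)

theorem exists_of_proper {G : Matrix α β (RatFunc ℝ)} (h : EntriesIn properAlg G) :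
    ∃ D, HasFeedthrough G D :=
  ⟨_, fun i j => ⟨G i j, h i j⟩, rfl, rfl⟩

variable {G H : Matrix α β (RatFunc ℝ)} {D E : Matrix α β ℝ}

theorem add (hG : HasFeedthrough G D) (hH : HasFeedthrough H E) : HasFeedthrough (G + H) (D + E) := by
  obtain ⟨G', rfl, rfl⟩ := hG
  obtain ⟨H', rfl, rfl⟩ := hH
  exact ⟨G' + H', by ext; simp, by ext; simp⟩

theorem sub (hG : HasFeedthrough G D) (hH : HasFeedthrough H E) : HasFeedthrough (G - H) (D - E) := by
  obtain ⟨G', rfl, rfl⟩ := hG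
  obtain ⟨H', rfl, rfl⟩ := hH
  exact ⟨G' - H', by ext; simp, by ext; simp⟩

theorem smul (c : ℝ) (hG : HasFeedthrough G D) : HasFeedthrough (c • G) (c • D) := by
  obtain ⟨G', rfl, rfl⟩ := hG
  exact ⟨c • G', by ext; simp, by ext; simp⟩

theorem mul [Fintype β] {H : Matrix β γ (RatFunc ℝ)} {E : Matrix β γ ℝ}
    (hG : HasFeedthrough G D) (hH : HasFeedthrough H E) : HasFeedthrough (G * H) (D * E) := by
  obtain ⟨G', rfl, rfl⟩ := hG
  obtain ⟨H', rfl, rfl⟩ := hH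
  exact ⟨G' * H', Matrix.map_mul, Matrix.map_mul⟩

variable [Fintype α] [DecidableEq α] {M : Matrix α α (RatFunc ℝ)} {D : Matrix α α ℝ}

theorem aeval (h : HasFeedthrough M D) (p : Polynomial ℝ) :
    HasFeedthrough (Polynomial.aeval M p) (Polynomial.aeval D p) := by
  obtain ⟨M', rfl, rfl⟩ := h
  refine ⟨Polynomial.aeval M' p, ?_, ?_⟩
  · exact (Polynomial.aeval_algHom_apply properAlg.val.mapMatrix M' p).symm
  · exact (Polynomial.aeval_algHom_apply feedthrough.mapMatrix M' p).symm

/-- A proper matrix that is invertible at infinity has a proper inverse. -/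
theorem isUnit_of_isUnit (h : HasFeedthrough M D) (hD : IsUnit D) :
    IsUnit M ∧ EntriesIn properAlg M⁻¹ := by
  obtain ⟨M', rfl, rfl⟩ := h
  -- The determinant commutes with evaluation at infinity, so it is a unit of the ring of proper
  -- functions.
  have hM : IsUnit M' := by
    rw [Matrix.isUnit_iff_isUnit_det] at hD ⊢
    apply isUnit_of_feedthrough_ne_zero
    rw [AlgHom.map_det]
    exact hD.ne_zero
  obtain ⟨N, hN⟩ := hM.exists_right_inv
  have hMN : M'.map properAlg.val * N.map properAlg.val = 1 := by
    rw [← Matrix.map_mul, hN]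
    simp
  refine ⟨IsUnit.of_mul_eq_one _ hMN, ?_⟩
  rw [Matrix.inv_eq_right_inv hMN]
  exact fun i j => (N i j).2

/-- An invertible proper matrix with a proper inverse is invertible at infinity. -/
theorem isUnit_of_inv_proper (h : HasFeedthrough M D) (hM : IsUnit M)
    (hp : EntriesIn properAlg M⁻¹) : IsUnit D := by
  obtain ⟨E, hE⟩ := exists_of_proper hp
  have h1 := h.mul hE
  rw [Matrix.mul_nonsing_inv _ ((Matrix.isUnit_iff_isUnit_det _).mp hM)] at h1
  exact IsUnit.of_mul_eq_one _ (h1.unique one)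

end HasFeedthrough

end Entries

/-! ### Schur stability: eigenvectors, block triangular matrices and convergence of trajectories. -/

section Schur

variable {ι κ : Type*} [Fintype ι] [Fintype κ]

/-- All complex eigenvalues lie in the open unit disc, in terms of eigenvectors. -/
def SchurStable (A : Matrix ι ι ℝ) : Prop :=
  ∀ (a : ℂ) (v : ι → ℂ), v ≠ 0 → (A.map (algebraMap ℝ ℂ)).mulVec v = a • v → ‖a‖ < 1

theorem schurStable_iff_det [DecidableEq ι] {A : Matrix ι ι ℝ} :
    SchurStable A ↔
      ∀ a : ℂ, (Matrix.scalar ι a - A.map (algebraMap ℝ ℂ)).det = 0 → ‖a‖ < 1 := by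
  have key : ∀ (a : ℂ) (v : ι → ℂ), (Matrix.scalar ι a - A.map (algebraMap ℝ ℂ)).mulVec v = 0 ↔
      (A.map (algebraMap ℝ ℂ)).mulVec v = a • v := by
    intro a v
    rw [Matrix.sub_mulVec, sub_eq_zero, eq_comm, Matrix.scalar_apply,
      ← Matrix.smul_one_eq_diagonal, Matrix.smul_mulVec, Matrix.one_mulVec]
  constructor
  · intro h a ha
    obtain ⟨v, hv, hv'⟩ := Matrix.exists_mulVec_eq_zero_iff.mpr ha
    exact h a v hv ((key a v).mp hv')
  · intro h a v hv hv'
    exact h a (Matrix.exists_mulVec_eq_zero_iff.mp ⟨v, hv, (key a v).mpr hv'⟩)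

theorem schurStable_iff_spectrum [DecidableEq ι] {A : Matrix ι ι ℝ} :
    SchurStable A ↔ ∀ a ∈ spectrum ℂ (A.map (algebraMap ℝ ℂ)), ‖a‖ < 1 := by
  rw [schurStable_iff_det]
  refine forall_congr' fun a => ?_
  rw [spectrum.mem_iff, Matrix.isUnit_iff_isUnit_det, isUnit_iff_ne_zero, not_not]
  rfl

theorem isSchur_iff {n : ℕ} {A : Matrix (Fin n) (Fin n) ℝ} : IsSchur A ↔ SchurStable A :=
  schurStable_iff_spectrum.symm

theorem SchurStable.submatrix {A : Matrix ι ι ℝ} (hA : SchurStable A) (e : κ ≃ ι) :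
    SchurStable (A.submatrix e e) := by
  intro a v hv h
  refine hA a (v ∘ e.symm) ?_ ?_
  · intro h0
    apply hv
    ext i
    simpa using congrFun h0 (e i)
  · have : (A.submatrix e e).map (algebraMap ℝ ℂ) = (A.map (algebraMap ℝ ℂ)).submatrix e e := rfl
    rw [this, Matrix.submatrix_mulVec_equiv] at h
    ext i
    simpa using congrFun h (e.symm i)

/-- The first component of an eigenvector is an eigenvector of `A`, unless it vanishes; then the
second component is an eigenvector of `D`. -/
theorem SchurStable.fromBlocks_zero₁₂ {A : Matrix ι ι ℝ} {C : Matrix κ ι ℝ} {D : Matrix κ κ ℝ}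
    (hA : SchurStable A) (hD : SchurStable D) : SchurStable (Matrix.fromBlocks A 0 C D) := by
  intro a v hv h
  rw [Matrix.fromBlocks_map, Matrix.fromBlocks_mulVec] at h
  have h1 : (A.map (algebraMap ℝ ℂ)).mulVec (v ∘ Sum.inl) = a • (v ∘ Sum.inl) := by
    ext i
    simpa using congrFun h (Sum.inl i)
  by_cases h0 : v ∘ Sum.inl = 0
  · refine hD a (v ∘ Sum.inr) ?_ ?_
    · intro h0'
      apply hv
      ext (i | i)
      · exact congrFun h0 i
      · exact congrFun h0' i
    · ext i
      simpa [h0] using congrFun h (Sum.inr i)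
  · exact hA a _ h0 h1

theorem SchurStable.fromBlocks_zero₂₁ {A : Matrix ι ι ℝ} {B : Matrix ι κ ℝ} {D : Matrix κ κ ℝ}
    (hA : SchurStable A) (hD : SchurStable D) : SchurStable (Matrix.fromBlocks A B 0 D) := by
  intro a v hv h
  rw [Matrix.fromBlocks_map, Matrix.fromBlocks_mulVec] at h
  have h1 : (D.map (algebraMap ℝ ℂ)).mulVec (v ∘ Sum.inr) = a • (v ∘ Sum.inr) := by
    ext i
    simpa using congrFun h (Sum.inr i)
  by_cases h0 : v ∘ Sum.inr = 0
  · refine hA a (v ∘ Sum.inl) ?_ ?_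
    · intro h0'
      apply hv
      ext (i | i)
      · exact congrFun h0' i
      · exact congrFun h0 i
    · ext i
      simpa [h0] using congrFun h (Sum.inl i)
  · exact hD a _ h0 h1

/-- If all real trajectories of `s⁺ = A s` converge to zero, then `A` is Schur stable. -/
theorem schurStable_of_tendsto [DecidableEq ι] {A : Matrix ι ι ℝ}
    (h : ∀ s : ι → ℝ, Filter.Tendsto (fun t : ℕ => (A ^ t).mulVec s) Filter.atTop (𝓝 0)) :
    SchurStable A := by
  intro a v hv hav
  have hpow : ∀ t : ℕ, ((A ^ t).map (algebraMap ℝ ℂ)).mulVec v = a ^ t • v := by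
    intro t
    induction t with
    | zero => simp
    | succ t ih =>
      rw [pow_succ, Matrix.map_mul, ← Matrix.mulVec_mulVec, hav, Matrix.mulVec_smul, ih,
        smul_smul, pow_succ, mul_comm]
  obtain ⟨i, hi⟩ := Function.ne_iff.mp hv
  -- The real and imaginary parts of the eigenvector serve as real initial states, so the hypothesis
  -- forces `a ^ t * v i` to zero.
  have hsplit : ∀ t : ℕ, a ^ t * v i =
      (((A ^ t).mulVec (fun j => (v j).re) i : ℝ) : ℂ) +
        (((A ^ t).mulVec (fun j => (v j).im) i : ℝ) : ℂ) * Complex.I := by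
    intro t
    have := congrFun (hpow t) i
    rw [Pi.smul_apply, smul_eq_mul] at this
    rw [← this]
    simp only [Matrix.mulVec, dotProduct, Matrix.map_apply, Complex.ofReal_sum,
      Complex.ofReal_mul, Finset.sum_mul, ← Finset.sum_add_distrib]
    refine Finset.sum_congr rfl fun j _ => ?_
    conv_lhs => rw [← Complex.re_add_im (v j)]
    simp only [Complex.coe_algebraMap]
    ring
  have hlim : Filter.Tendsto (fun t : ℕ => a ^ t * v i) Filter.atTop (𝓝 0) := by
    have hr := (tendsto_pi_nhds.mp (h fun j => (v j).re)) i
    have hi := (tendsto_pi_nhds.mp (h fun j => (v j).im)) i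
    have hr' := (Complex.continuous_ofReal.tendsto _).comp hr
    have hi' := ((Complex.continuous_ofReal.tendsto _).comp hi).mul_const Complex.I
    have := hr'.add hi'
    simp only [Pi.zero_apply, Complex.ofReal_zero, zero_mul, add_zero] at this
    refine this.congr fun t => ?_
    rw [hsplit]
    rfl
  by_contra hlt
  rw [not_lt] at hlt
  have hn := hlim.norm
  rw [norm_zero] at hn
  have hpos : 0 < ‖v i‖ := norm_pos_iff.mpr hi
  have hge : ∀ t : ℕ, ‖v i‖ ≤ ‖a ^ t * v i‖ := by
    intro t
    rw [norm_mul, norm_pow]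
    exact le_mul_of_one_le_left hpos.le (one_le_pow₀ hlt)
  exact absurd (ge_of_tendsto' hn hge) (not_le.mpr hpos)

section Banach

/-- By Gelfand's formula the norm of `a ^ t` is eventually at most `r ^ t` for some `r < 1`. -/
theorem tendsto_pow_of_spectralRadius_lt_one {𝔸 : Type*} [NormedRing 𝔸] [NormedAlgebra ℂ 𝔸]
    [CompleteSpace 𝔸] {a : 𝔸} (h : spectralRadius ℂ a < 1) :
    Filter.Tendsto (fun t : ℕ => a ^ t) Filter.atTop (𝓝 0) := by
  obtain ⟨r, hr, hr1⟩ := ENNReal.lt_iff_exists_nnreal_btwn.mp h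
  have hr1' : r < 1 := by exact_mod_cast hr1
  have h1 := (spectrum.pow_nnnorm_pow_one_div_tendsto_nhds_spectralRadius a).eventually_lt_const hr
  refine squeeze_zero_norm' (a := fun t : ℕ => (r : ℝ) ^ t) ?_
    (tendsto_pow_atTop_nhds_zero_of_lt_one r.2 (by exact_mod_cast hr1'))
  filter_upwards [h1, Filter.eventually_gt_atTop 0] with t ht ht0
  have ht0' : (0 : ℝ) < t := by exact_mod_cast ht0
  have h2 : (‖a ^ t‖₊ : ENNReal) ≤ (r : ENNReal) ^ t := by
    have := ENNReal.rpow_le_rpow ht.le ht0'.le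
    rwa [← ENNReal.rpow_mul, one_div_mul_cancel ht0'.ne', ENNReal.rpow_one,
      ENNReal.rpow_natCast] at this
  have h3 : ‖a ^ t‖₊ ≤ r ^ t := by exact_mod_cast h2
  exact_mod_cast h3

attribute [local instance] Matrix.linftyOpNormedRing Matrix.linftyOpNormedAlgebra

theorem SchurStable.tendsto_complex_pow [DecidableEq ι] {A : Matrix ι ι ℝ} (hA : SchurStable A)
    (v : ι → ℂ) : Filter.Tendsto (fun t : ℕ => (A.map (algebraMap ℝ ℂ) ^ t).mulVec v)
      Filter.atTop (𝓝 0) := by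
  rw [schurStable_iff_spectrum] at hA
  -- An empty index set gives the trivial algebra, where the bound on the spectral radius taken from
  -- the spectrum below does not apply.
  rcases isEmpty_or_nonempty ι with hι | hι
  · exact tendsto_pi_nhds.mpr fun i => hι.elim i
  have h1 : spectralRadius ℂ (A.map (algebraMap ℝ ℂ)) < 1 := by
    have := spectrum.spectralRadius_lt_of_forall_lt (A.map (algebraMap ℝ ℂ)) (r := 1)
      fun k hk => by exact_mod_cast hA k hk
    exact_mod_cast this
  have h2 := tendsto_pow_of_spectralRadius_lt_one h1
  have hc : Continuous fun M : Matrix ι ι ℂ => M.mulVec v :=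
    LinearMap.continuous_of_finiteDimensional
      ((LinearMap.applyₗ v).comp (Matrix.toLin' (R := ℂ) (n := ι) (m := ι)).toLinearMap)
  have := (hc.tendsto 0).comp h2
  rwa [Matrix.zero_mulVec] at this

end Banach

/-- Trajectories of a Schur stable linear system converge to zero. -/
theorem SchurStable.tendsto_zero {A : Matrix ι ι ℝ} (hA : SchurStable A) {s : ℕ → ι → ℝ}
    (hs : ∀ t, s (t + 1) = A.mulVec (s t)) : Filter.Tendsto s Filter.atTop (𝓝 0) := by
  classical
  have hpow : ∀ t, (fun i => ((s t i : ℝ) : ℂ)) =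
      (A.map (algebraMap ℝ ℂ) ^ t).mulVec fun i => ((s 0 i : ℝ) : ℂ) := by
    intro t
    induction t with
    | zero => simp
    | succ t ih =>
      rw [pow_succ', ← Matrix.mulVec_mulVec, ← ih, hs]
      ext i
      simp [Matrix.mulVec, dotProduct]
  have h := hA.tendsto_complex_pow fun i => ((s 0 i : ℝ) : ℂ)
  simp only [← hpow] at h
  rw [tendsto_pi_nhds] at h ⊢
  intro i
  have := (Complex.continuous_re.tendsto _).comp (h i)
  simpa [Function.comp_def] using this

end Schur

/-! ### The resolvent `(zI - A)⁻¹` and transfer matrices of realizations. -/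

section Resolvent

variable {ι κ : Type*} [Fintype ι] [DecidableEq ι] [Fintype κ] [DecidableEq κ]

/-- The matrix `zI - A`. -/
def pencil (A : Matrix ι ι ℝ) : Matrix ι ι (RatFunc ℝ) :=
  Matrix.scalar ι (RatFunc.X : RatFunc ℝ) - toTM A

theorem pencil_eq (A : Matrix ι ι ℝ) :
    pencil A = (algebraMap (Polynomial ℝ) (RatFunc ℝ)).mapMatrix A.charmatrix := by
  ext i j
  simp [pencil, toTM, Matrix.charmatrix_apply, Matrix.diagonal_apply, apply_ite]

theorem det_pencil (A : Matrix ι ι ℝ) :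
    (pencil A).det = algebraMap (Polynomial ℝ) (RatFunc ℝ) A.charpoly := by
  rw [pencil_eq, ← RingHom.map_det]; rfl

theorem isUnit_det_pencil (A : Matrix ι ι ℝ) : IsUnit (pencil A).det := by
  rw [det_pencil, isUnit_iff_ne_zero]
  simpa using A.charpoly_monic.ne_zero

theorem pencil_mul_inv (A : Matrix ι ι ℝ) : pencil A * (pencil A)⁻¹ = 1 :=
  Matrix.mul_nonsing_inv _ (isUnit_det_pencil A)

theorem inv_mul_pencil (A : Matrix ι ι ℝ) : (pencil A)⁻¹ * pencil A = 1 :=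
  Matrix.nonsing_inv_mul _ (isUnit_det_pencil A)

/-- `(zI - A)⁻¹` is strictly proper. -/
theorem hasFeedthrough_pencil_inv (A : Matrix ι ι ℝ) : HasFeedthrough (pencil A)⁻¹ 0 := by
  apply HasFeedthrough.of_X_smul
  rw [toTM_zero, sub_zero]
  -- `I - z⁻¹ A` equals `I` at infinity, so its inverse `z (zI - A)⁻¹` is proper.
  have h1 : HasFeedthrough ((1 : Matrix ι ι (RatFunc ℝ)) - (RatFunc.X : RatFunc ℝ)⁻¹ • toTM A) 1 := by
    apply HasFeedthrough.of_X_smul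
    rw [toTM_one, sub_sub_cancel_left, smul_neg, smul_smul, mul_inv_cancel₀ RatFunc.X_ne_zero,
      one_smul]
    exact (EntriesIn.const A).neg
  have h2 : (1 - (RatFunc.X : RatFunc ℝ)⁻¹ • toTM A) * ((RatFunc.X : RatFunc ℝ) • (pencil A)⁻¹) =
      1 := by
    rw [Matrix.mul_smul, ← Matrix.smul_mul, smul_sub, smul_smul, mul_inv_cancel₀ RatFunc.X_ne_zero,
      one_smul, Matrix.smul_one_eq_diagonal]
    exact pencil_mul_inv A
  have h3 := (h1.isUnit_of_isUnit isUnit_one).2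
  rwa [Matrix.inv_eq_right_inv h2] at h3

/-- Cramer's rule: the adjugate is polynomial, and the determinant is the characteristic polynomial,
whose roots are the eigenvalues. -/
theorem SchurStable.entriesIn_pencil_inv {A : Matrix ι ι ℝ} (hA : SchurStable A) :
    EntriesIn rhAlg (pencil A)⁻¹ := by
  intro i j
  refine ⟨(hasFeedthrough_pencil_inv A).proper i j, ?_⟩
  rw [schurStable_iff_det] at hA
  have hdet : (algebraMap (Polynomial ℝ) (RatFunc ℝ) A.charpoly)⁻¹ ∈ stableAlg := by
    rw [← one_div, ← map_one (algebraMap (Polynomial ℝ) (RatFunc ℝ)), mem_stableAlg]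
    refine stable_div fun a ha => hA a ?_
    rw [← ha, Polynomial.aeval_def, ← Polynomial.eval_map, ← Matrix.charpoly_map,
      Matrix.eval_charpoly]
  have hadj : (pencil A).adjugate i j ∈ stableAlg := by
    rw [pencil_eq, ← RingHom.map_adjugate, mem_stableAlg]
    simp
  rw [Matrix.inv_def, Ring.inverse_eq_inv, det_pencil]
  exact stableAlg.mul_mem hdet hadj

/-- The transfer matrix of a realization with an arbitrary finite index type for the state. -/
def realize {α β : Type*} (A : Matrix ι ι ℝ) (B : Matrix ι β ℝ) (C : Matrix α ι ℝ)
    (D : Matrix α β ℝ) : Matrix α β (RatFunc ℝ) :=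
  toTM C * (pencil A)⁻¹ * toTM B + toTM D

theorem transfer_eq_realize {n p m : ℕ} (A : Matrix (Fin n) (Fin n) ℝ) (B : Matrix (Fin n) (Fin m) ℝ)
    (C : Matrix (Fin p) (Fin n) ℝ) (D : Matrix (Fin p) (Fin m) ℝ) :
    transfer A B C D = realize A B C D := rfl

theorem hasFeedthrough_realize {α β : Type*} (A : Matrix ι ι ℝ) (B : Matrix ι β ℝ)
    (C : Matrix α ι ℝ) (D : Matrix α β ℝ) : HasFeedthrough (realize A B C D) D := by
  have := (((HasFeedthrough.const C).mul (hasFeedthrough_pencil_inv A)).mul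
    (HasFeedthrough.const B)).add (HasFeedthrough.const D)
  rwa [Matrix.mul_zero, Matrix.zero_mul, zero_add] at this

theorem pencil_submatrix (A : Matrix ι ι ℝ) (e : κ ≃ ι) :
    pencil (A.submatrix e e) = (pencil A).submatrix e e := by
  ext i j
  simp [pencil, toTM, Matrix.diagonal_apply]

theorem realize_submatrix {α β : Type*} (A : Matrix ι ι ℝ) (B : Matrix ι β ℝ)
    (C : Matrix α ι ℝ) (D : Matrix α β ℝ) (e : κ ≃ ι) :
    realize (A.submatrix e e) (B.submatrix e id) (C.submatrix id e) D = realize A B C D := by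
  have hB : toTM (B.submatrix e id) = (toTM B).submatrix e id := rfl
  have hC : toTM (C.submatrix id e) = (toTM C).submatrix id e := rfl
  rw [realize, realize, pencil_submatrix, Matrix.inv_submatrix_equiv, hB, hC,
    Matrix.submatrix_mul_equiv, Matrix.submatrix_mul_equiv, Matrix.submatrix_id_id]

end Resolvent

/-! ### Companion matrices realize strictly proper fractions. -/

section Companion

open Polynomial

/-- The companion matrix of a monic polynomial of degree `m + 1`, acting on `(1, z, …, z ^ m)`. -/
def shiftCompanion (m : ℕ) (q : ℝ[X]) : Matrix (Fin (m + 1)) (Fin (m + 1)) ℝ :=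
  fun i j => if i = Fin.last m then -q.coeff j else if (j : ℕ) = i + 1 then 1 else 0

variable {m : ℕ} {q : ℝ[X]}

theorem sum_shiftCompanion_mul_castSucc {S : Type*} [CommRing S] (f : ℝ →+* S)
    (v : Fin (m + 1) → S) (i : Fin m) :
    ∑ j, f (shiftCompanion m q i.castSucc j) * v j = v i.succ := by
  rw [Finset.sum_eq_single i.succ]
  · simp [shiftCompanion, (Fin.castSucc_lt_last i).ne]
  · intro j _ hj
    have : (j : ℕ) ≠ i + 1 := fun h => hj (Fin.ext (by simpa using h))
    simp [shiftCompanion, (Fin.castSucc_lt_last i).ne, this]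
  · simp

theorem sum_shiftCompanion_mul_last {S : Type*} [CommRing S] (f : ℝ →+* S)
    (hq : q.Monic) (hm : q.natDegree = m + 1) (a : S) :
    ∑ j, f (shiftCompanion m q (Fin.last m) j) * a ^ (j : ℕ) = a ^ (m + 1) - q.eval₂ f a := by
  have h1 : q.coeff (m + 1) = 1 := by rw [← hm]; exact hq
  rw [eval₂_eq_sum_range, hm, Finset.sum_range_succ, h1, map_one, one_mul, ← Fin.sum_univ_eq_sum_range
    (fun j => f (q.coeff j) * a ^ j)]
  simp [shiftCompanion]

/-- An eigenvector for `a` is a multiple of `(1, a, …, a ^ m)`, and the last row then says that `a`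
is a root of `q`. -/
theorem schurStable_shiftCompanion (hq : q.Monic) (hm : q.natDegree = m + 1)
    (hs : ∀ a : ℂ, aeval a q = 0 → ‖a‖ < 1) : SchurStable (shiftCompanion m q) := by
  intro a v hv h
  have hrow : ∀ i, ∑ j, algebraMap ℝ ℂ (shiftCompanion m q i j) * v j = a * v i :=
    fun i => congrFun h i
  have hpow : ∀ i : Fin (m + 1), v i = a ^ (i : ℕ) * v 0 := by
    intro i
    induction i using Fin.induction with
    | zero => simp
    | succ i ih =>
      rw [← sum_shiftCompanion_mul_castSucc (q := q) (algebraMap ℝ ℂ) v i, hrow, ih]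
      simp only [Fin.val_castSucc, Fin.val_succ]
      ring
  have h0 : v 0 ≠ 0 := by
    intro h0
    apply hv
    ext i
    rw [hpow, h0, mul_zero, Pi.zero_apply]
  have hlast := hrow (Fin.last m)
  have hsum : ∑ j, algebraMap ℝ ℂ (shiftCompanion m q (Fin.last m) j) * v j =
      (∑ j, algebraMap ℝ ℂ (shiftCompanion m q (Fin.last m) j) * a ^ (j : ℕ)) * v 0 := by
    rw [Finset.sum_mul]
    refine Finset.sum_congr rfl fun j _ => ?_
    rw [hpow j, mul_assoc]
  rw [hsum, sum_shiftCompanion_mul_last _ hq hm, hpow (Fin.last m), Fin.val_last] at hlast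
  apply hs
  rw [aeval_def]
  have : q.eval₂ (algebraMap ℝ ℂ) a * v 0 = 0 := by linear_combination -hlast
  exact (mul_eq_zero.mp this).resolve_right h0

/-- The column with entries `z ^ i / q` solves `(zI - A) w = e_m`; pairing it with the coefficients
of `p` gives `p / q`. -/
theorem realize_shiftCompanion (hq : q.Monic) (hm : q.natDegree = m + 1) {p : ℝ[X]}
    (hp : p.natDegree ≤ m) :
    realize (shiftCompanion m q) (Matrix.of fun i (_ : Fin 1) => if i = Fin.last m then 1 else 0)
      (Matrix.of fun (_ : Fin 1) j => p.coeff j) 0 =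
      Matrix.of fun _ _ => algebraMap ℝ[X] (RatFunc ℝ) p / algebraMap ℝ[X] (RatFunc ℝ) q := by
  have hq0 : algebraMap ℝ[X] (RatFunc ℝ) q ≠ 0 := by simpa using hq.ne_zero
  have heval : ∀ r : ℝ[X], r.eval₂ (RatFunc.C : ℝ →+* RatFunc ℝ) RatFunc.X =
      algebraMap ℝ[X] (RatFunc ℝ) r := by
    intro r
    rw [← RatFunc.algebraMap_eq_C, ← RatFunc.algebraMap_X, ← aeval_def, aeval_algebraMap_apply,
      aeval_X_left_apply]
  let w : Matrix (Fin (m + 1)) (Fin 1) (RatFunc ℝ) :=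
    Matrix.of fun i _ => RatFunc.X ^ (i : ℕ) * (algebraMap ℝ[X] (RatFunc ℝ) q)⁻¹
  have hw : pencil (shiftCompanion m q) * w =
      toTM (Matrix.of fun i (_ : Fin 1) => if i = Fin.last m then (1 : ℝ) else 0) := by
    ext i k
    have hsub : (pencil (shiftCompanion m q) * w) i k = RatFunc.X * w i k -
        ∑ j, (RatFunc.C : ℝ →+* RatFunc ℝ) (shiftCompanion m q i j) * w j k := by
      rw [pencil, Matrix.sub_mul, Matrix.sub_apply, Matrix.scalar_apply, Matrix.diagonal_mul]
      rfl
    rw [hsub]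
    induction i using Fin.lastCases with
    | last =>
      simp only [w, Matrix.of_apply, ← mul_assoc, ← Finset.sum_mul]
      rw [sum_shiftCompanion_mul_last _ hq hm, heval, Fin.val_last, ← sub_mul]
      simp only [toTM, Matrix.of_apply, Matrix.map_apply, if_pos, map_one]
      rw [← pow_succ', sub_sub_cancel, mul_inv_cancel₀ hq0]
    | cast i =>
      rw [sum_shiftCompanion_mul_castSucc RatFunc.C (fun j => w j k)]
      simp only [w, toTM, Matrix.of_apply, Matrix.map_apply, (Fin.castSucc_lt_last i).ne, if_false, map_zero,
        Fin.val_castSucc, Fin.val_succ]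
      ring
  have hw' : (pencil (shiftCompanion m q))⁻¹ *
      toTM (Matrix.of fun i (_ : Fin 1) => if i = Fin.last m then (1 : ℝ) else 0) = w := by
    rw [← hw, ← Matrix.mul_assoc, inv_mul_pencil, Matrix.one_mul]
  rw [realize, Matrix.mul_assoc, hw', toTM_zero, add_zero]
  ext i k
  rw [Matrix.mul_apply, div_eq_mul_inv, ← heval p, eval₂_eq_sum_range' _ (Nat.lt_succ_of_le hp),
    ← Fin.sum_univ_eq_sum_range
      (fun j => (RatFunc.C : ℝ →+* RatFunc ℝ) (p.coeff j) * RatFunc.X ^ j), Finset.sum_mul]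
  refine Finset.sum_congr rfl fun j _ => ?_
  simp only [w, toTM, Matrix.of_apply, Matrix.map_apply]
  ring

end Companion

/-! ### Every matrix over `rhAlg` has a realization with a Schur state matrix. -/

section Realization

variable {α β γ : Type*} {ι κ : Type*} [Fintype ι] [DecidableEq ι] [Fintype κ] [DecidableEq κ]

/-- `G` has a state-space realization with a Schur stable state matrix. -/
def HasSchurRealization (G : Matrix α β (RatFunc ℝ)) : Prop :=
  ∃ (k : ℕ) (A : Matrix (Fin k) (Fin k) ℝ) (B : Matrix (Fin k) β ℝ) (C : Matrix α (Fin k) ℝ)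
    (D : Matrix α β ℝ), SchurStable A ∧ realize A B C D = G

namespace HasSchurRealization

theorem of_realize {A : Matrix ι ι ℝ} (hA : SchurStable A) (B : Matrix ι β ℝ) (C : Matrix α ι ℝ)
    (D : Matrix α β ℝ) : HasSchurRealization (realize A B C D) :=
  ⟨Fintype.card ι, _, _, _, D, hA.submatrix (Fintype.equivFin ι).symm, realize_submatrix A B C D _⟩

theorem const (D : Matrix α β ℝ) : HasSchurRealization (toTM D) := by
  refine ⟨0, 0, 0, 0, D, fun a v hv => (hv (Subsingleton.elim _ _)).elim, ?_⟩
  rw [realize, toTM_zero, Matrix.zero_mul, Matrix.zero_mul, zero_add]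

theorem pencil_fromBlocks (A : Matrix ι ι ℝ) (B : Matrix ι κ ℝ) (C : Matrix κ ι ℝ)
    (D : Matrix κ κ ℝ) : pencil (Matrix.fromBlocks A B C D) =
      Matrix.fromBlocks (pencil A) (-toTM B) (-toTM C) (pencil D) := by
  ext (i | i) (j | j) <;> simp [pencil, toTM, Matrix.diagonal_apply]

theorem pencil_fromBlocks_diag_inv (A : Matrix ι ι ℝ) (D : Matrix κ κ ℝ) :
    (pencil (Matrix.fromBlocks A 0 0 D))⁻¹ = Matrix.fromBlocks (pencil A)⁻¹ 0 0 (pencil D)⁻¹ := by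
  apply Matrix.inv_eq_right_inv
  rw [pencil_fromBlocks, Matrix.fromBlocks_multiply]
  simp [pencil_mul_inv]

theorem add {G H : Matrix α β (RatFunc ℝ)} (hG : HasSchurRealization G)
    (hH : HasSchurRealization H) : HasSchurRealization (G + H) := by
  obtain ⟨k, A, B, C, D, hA, rfl⟩ := hG
  obtain ⟨k', A', B', C', D', hA', rfl⟩ := hH
  have h := of_realize (hA.fromBlocks_zero₁₂ (C := 0) hA') (Matrix.fromRows B B')
    (Matrix.fromCols C C') (D + D')
  convert h using 1
  rw [realize, realize, realize, pencil_fromBlocks_diag_inv, toTM_fromRows, toTM_fromCols,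
    Matrix.fromCols_mul_fromBlocks, Matrix.fromCols_mul_fromRows, toTM_add]
  simp only [Matrix.mul_zero, add_zero, zero_add]
  abel

theorem const_mul [Fintype α] {G : Matrix α β (RatFunc ℝ)} (E : Matrix γ α ℝ)
    (hG : HasSchurRealization G) : HasSchurRealization (toTM E * G) := by
  obtain ⟨k, A, B, C, D, hA, rfl⟩ := hG
  refine ⟨k, A, B, E * C, E * D, hA, ?_⟩
  simp only [realize, toTM_mul, Matrix.mul_add, Matrix.mul_assoc]

theorem mul_const [Fintype β] {G : Matrix α β (RatFunc ℝ)} (E : Matrix β γ ℝ)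
    (hG : HasSchurRealization G) : HasSchurRealization (G * toTM E) := by
  obtain ⟨k, A, B, C, D, hA, rfl⟩ := hG
  refine ⟨k, A, B * E, C, D * E, hA, ?_⟩
  simp only [realize, toTM_mul, Matrix.add_mul, Matrix.mul_assoc]

theorem sum {σ : Type*} (s : Finset σ) {G : σ → Matrix α β (RatFunc ℝ)}
    (h : ∀ i ∈ s, HasSchurRealization (G i)) : HasSchurRealization (∑ i ∈ s, G i) := by
  classical
  induction s using Finset.induction_on with
  | empty => simpa using const (0 : Matrix α β ℝ)
  | insert i s hi ih =>
    rw [Finset.sum_insert hi]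
    exact (h i (Finset.mem_insert_self i s)).add
      (ih fun j hj => h j (Finset.mem_insert_of_mem hj))

open Polynomial in
theorem scalar {f : RatFunc ℝ} (hf : f ∈ rhAlg) :
    HasSchurRealization (Matrix.of fun (_ _ : Fin 1) => f) := by
  obtain ⟨c, hc⟩ := exists_feedthrough hf.1
  set r := f - RatFunc.C c with hr
  have hstab : r ∈ stableAlg := stableAlg.sub_mem hf.2 (C_mem _ c)
  have hfr : (Matrix.of fun (_ _ : Fin 1) => f) =
      Matrix.of (fun _ _ => r) + toTM (Matrix.of fun _ _ => c) := by
    ext i j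
    simp [hr, toTM]
  rw [hfr]
  refine add ?_ (const _)
  -- The zero function has denominator `1`, whose degree is too small for a companion matrix of size
  -- `m + 1`.
  by_cases h0 : r = 0
  · simpa [h0] using! const (0 : Matrix (Fin 1) (Fin 1) ℝ)
  have hdeg : r.num.natDegree < r.denom.natDegree := by
    rw [mem_properAlg, RatFunc.intDegree_mul RatFunc.X_ne_zero h0, RatFunc.intDegree_X,
      RatFunc.intDegree] at hc
    omega
  obtain ⟨m, hm⟩ : ∃ m, r.denom.natDegree = m + 1 := ⟨r.denom.natDegree - 1, by omega⟩
  have h := of_realize (schurStable_shiftCompanion r.monic_denom hm hstab)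
    (Matrix.of fun i (_ : Fin 1) => if i = Fin.last m then 1 else 0)
    (Matrix.of fun (_ : Fin 1) j => r.num.coeff j) 0
  rwa [realize_shiftCompanion r.monic_denom hm (by omega), RatFunc.num_div_denom] at h

theorem of_entriesIn [Fintype α] [Fintype β] [DecidableEq α] [DecidableEq β]
    {G : Matrix α β (RatFunc ℝ)} (hG : EntriesIn rhAlg G) : HasSchurRealization G := by
  rw [Matrix.matrix_eq_sum_single G]
  refine sum _ fun i _ => sum _ fun j _ => ?_
  have h := ((scalar (hG i j)).const_mul (Matrix.single i 0 1)).mul_const (Matrix.single 0 j 1)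
  convert h using 1
  ext i' j'
  simp only [toTM, Matrix.mul_apply, Matrix.single_apply, Matrix.map_apply, Matrix.of_apply,
    Fin.sum_univ_one, true_and, and_true, eq_comm (a := i), eq_comm (a := j)]
  split_ifs <;> simp_all

end HasSchurRealization

end Realization

/-! ### From stabilizing controllers to input-output parameters. -/

theorem one_sub_fromBlocks_zero {β γ R : Type*} [DecidableEq β] [DecidableEq γ] [Ring R] (B : Matrix β γ R)
    (C : Matrix γ β R) : 1 - Matrix.fromBlocks 0 B C 0 = Matrix.fromBlocks 1 (-B) (-C) 1 := by
  ext (i | i) (j | j) <;> simp [Matrix.one_apply]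

section Loop

variable {ι β : Type*} [Fintype ι] [DecidableEq ι] [Fintype β] [DecidableEq β]

/-- State-space formula for the inverse of `1 - G`. -/
theorem one_sub_realize_mul {A : Matrix ι ι ℝ} {B : Matrix ι β ℝ} {C : Matrix β ι ℝ}
    {D E : Matrix β β ℝ} (hE : (1 - D) * E = 1) :
    (1 - realize A B C D) * (toTM E +
      toTM E * toTM C * (pencil (A + B * E * C))⁻¹ * (toTM B * toTM E)) = 1 := by
  have hE' : (1 - toTM D) * toTM E = 1 := by
    rw [← toTM_one, ← toTM_sub, ← toTM_mul, hE]
  have hp : pencil (A + B * E * C) = pencil A - toTM B * toTM E * toTM C := by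
    simp only [pencil, toTM_add, toTM_mul]
    abel
  have h1 := pencil_mul_inv (A + B * E * C)
  set ρ := (pencil (A + B * E * C))⁻¹
  rw [hp] at h1
  have h2 : ρ - (pencil A)⁻¹ * (toTM B * toTM E * toTM C) * ρ = (pencil A)⁻¹ := by
    have := congrArg ((pencil A)⁻¹ * ·) h1
    simpa only [Matrix.sub_mul, Matrix.mul_sub, ← Matrix.mul_assoc, inv_mul_pencil, Matrix.one_mul,
      Matrix.mul_one] using this
  have h3 : (1 - realize A B C D) * (toTM E + toTM E * toTM C * ρ * (toTM B * toTM E)) =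
      (1 - toTM D) * toTM E + ((1 - toTM D) * toTM E) * toTM C * ρ * (toTM B * toTM E)
        - toTM C * ((pencil A)⁻¹ + (pencil A)⁻¹ * (toTM B * toTM E * toTM C) * ρ) *
          (toTM B * toTM E) := by
    simp only [realize, Matrix.sub_mul, Matrix.add_mul, Matrix.mul_add,
      ← Matrix.mul_assoc, Matrix.one_mul]
    abel
  rw [h3, hE', Matrix.one_mul]
  conv_lhs => enter [2, 1, 2, 1]; rw [← h2]
  rw [sub_add_cancel, add_sub_cancel_right]

end Loop

namespace Plant

variable {n nw nu nz ny : ℕ} (P : Plant n nw nu nz ny)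

theorem mem_iopSubspace_iff {q : IOParam nu ny} : q ∈ P.iopSubspace ↔
    (q.Y = 1 + P.P₂₂ * q.U ∧ q.W = P.P₂₂ * q.Z ∧ q.W = q.Y * P.P₂₂ ∧ q.Z = 1 + q.U * P.P₂₂) ∧
    EntriesIn rhAlg q.Y ∧ EntriesIn rhAlg q.U ∧ EntriesIn rhAlg q.W ∧ EntriesIn rhAlg q.Z := by
  rw [iopSubspace, Set.mem_ofPred_eq, Matrix.fromCols_mul_fromBlocks,
    Matrix.fromBlocks_mul_fromRows, Matrix.fromCols_ext_iff, Matrix.fromRows_ext_iff]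
  simp only [mem_RHinf_iff, Matrix.one_mul, Matrix.mul_one, Matrix.neg_mul, Matrix.mul_neg,
    ← and_assoc]
  have e1 : q.Y + -(P.P₂₂ * q.U) = 1 ↔ q.Y = 1 + P.P₂₂ * q.U := by
    rw [← sub_eq_add_neg, sub_eq_iff_eq_add]
  have e2 : q.W + -(P.P₂₂ * q.Z) = 0 ↔ q.W = P.P₂₂ * q.Z := by
    rw [← sub_eq_add_neg, sub_eq_zero]
  have e3 : -(q.Y * P.P₂₂) + q.W = 0 ↔ q.W = q.Y * P.P₂₂ := by
    rw [neg_add_eq_zero, eq_comm]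
  have e4 : -(q.U * P.P₂₂) + q.Z = 1 ↔ q.Z = 1 + q.U * P.P₂₂ := by
    rw [neg_add_eq_iff_eq_add, add_comm]
  rw [e1, e2, e3, e4]

theorem hasFeedthrough_P₂₂ : HasFeedthrough P.P₂₂ P.D₂₂ := hasFeedthrough_realize _ _ _ _

/-- Internal stability makes the state matrix of the closed loop Schur stable. -/
theorem schurStable_closedLoop {k : ℕ} {κ : Controller k nu ny} (h : P.InternallyStable κ)
    {E : Matrix (Fin ny ⊕ Fin nu) (Fin ny ⊕ Fin nu) ℝ}
    (hE : (1 - Matrix.fromBlocks 0 P.D₂₂ κ.D 0) * E = 1) :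
    SchurStable (Matrix.fromBlocks P.A 0 0 κ.A +
      Matrix.fromBlocks 0 P.B₂ κ.B 0 * E * Matrix.fromBlocks P.C₂ 0 0 κ.C) := by
  apply schurStable_of_tendsto
  intro s₀
  set 𝔸 := Matrix.fromBlocks P.A 0 0 κ.A
  set 𝔹 := Matrix.fromBlocks 0 P.B₂ κ.B 0
  set ℭ := Matrix.fromBlocks P.C₂ 0 0 κ.C
  set M := 𝔸 + 𝔹 * E * ℭ with hM
  let s : ℕ → Fin n ⊕ Fin k → ℝ := fun t => (M ^ t).mulVec s₀
  -- The loop signals `(y, u)` are determined by the states because `E` inverts the static part of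
  -- the loop.
  let v : ℕ → Fin ny ⊕ Fin nu → ℝ := fun t => (E * ℭ).mulVec (s t)
  have hs : ∀ t, s (t + 1) = 𝔸.mulVec (s t) + 𝔹.mulVec (v t) := by
    intro t
    simp only [s, v]
    rw [pow_succ', ← Matrix.mulVec_mulVec, hM, Matrix.add_mulVec, Matrix.mulVec_mulVec _ 𝔹,
      Matrix.mul_assoc]
  have hv : ∀ t, v t = ℭ.mulVec (s t) + (Matrix.fromBlocks 0 P.D₂₂ κ.D 0).mulVec (v t) := by
    intro t
    rw [← sub_eq_iff_eq_add]
    conv_lhs => enter [1]; rw [← Matrix.one_mulVec (v t)]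
    rw [← Matrix.sub_mulVec]
    simp only [v]
    rw [Matrix.mulVec_mulVec, ← Matrix.mul_assoc, hE, Matrix.one_mul]
  have htraj : P.IsTrajectory κ (fun t => s t ∘ Sum.inl) (fun t => s t ∘ Sum.inr)
      (fun t => v t ∘ Sum.inr) (fun t => v t ∘ Sum.inl) := by
    intro t
    have h1 := hs t
    have h2 := hv t
    rw [Matrix.fromBlocks_mulVec, Matrix.fromBlocks_mulVec] at h1 h2
    refine ⟨?_, ?_, ?_, ?_⟩
    · ext i; simpa using congrFun h1 (Sum.inl i)
    · ext i; simpa using congrFun h2 (Sum.inl i)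
    · ext i; simpa using congrFun h1 (Sum.inr i)
    · ext i; simpa using congrFun h2 (Sum.inr i)
  obtain ⟨hx, hξ⟩ := h.2 _ _ _ _ htraj
  rw [tendsto_pi_nhds] at hx hξ ⊢
  rintro (i | i)
  · exact hx i
  · exact hξ i

/-- The quadruple consists of the blocks of the inverse `N` of the loop matrix. The two identities
expressing that `N` is a right and a left inverse contain all the required equations. -/
theorem exists_mem_iopSubspace_of_mem_Cstab {K : TransferMatrix nu ny} (hK : K ∈ P.Cstab) :
    EntriesIn properAlg K ∧ ∃ q ∈ P.iopSubspace, q.U = K * q.Y ∧ q.Y * (1 - P.P₂₂ * K) = 1 := by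
  obtain ⟨k, κ, -, -, rfl, hst⟩ := hK
  set K := transfer κ.A κ.B κ.C κ.D with hKdef
  refine ⟨(hasFeedthrough_realize κ.A κ.B κ.C κ.D).proper, ?_⟩
  -- A Schur complement reduces the determinant to `det (1 - κ.D * P.D₂₂)`, which equals `det (1 -
  -- P.D₂₂ * κ.D)`.
  have hunit : IsUnit (1 - Matrix.fromBlocks 0 P.D₂₂ κ.D 0) := by
    have h1 := hst.1
    rw [Matrix.isUnit_iff_isUnit_det] at h1 ⊢
    rw [one_sub_fromBlocks_zero, Matrix.det_fromBlocks_one₁₁]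
    simpa [Matrix.det_one_sub_mul_comm κ.D] using h1
  obtain ⟨E, hE⟩ := hunit.exists_right_inv
  have hS := P.schurStable_closedLoop hst hE
  have hinv := one_sub_realize_mul (A := Matrix.fromBlocks P.A 0 0 κ.A)
    (B := Matrix.fromBlocks 0 P.B₂ κ.B 0) (C := Matrix.fromBlocks P.C₂ 0 0 κ.C) hE
  have hN := (EntriesIn.const (R := rhAlg) E).add ((((EntriesIn.const E).mul (EntriesIn.const
    (Matrix.fromBlocks P.C₂ 0 0 κ.C))).mul hS.entriesIn_pencil_inv).mul
      ((EntriesIn.const (Matrix.fromBlocks 0 P.B₂ κ.B 0)).mul (EntriesIn.const E)))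
  set N := toTM E + toTM E * toTM (Matrix.fromBlocks P.C₂ 0 0 κ.C) *
    (pencil (Matrix.fromBlocks P.A 0 0 κ.A +
      Matrix.fromBlocks 0 P.B₂ κ.B 0 * E * Matrix.fromBlocks P.C₂ 0 0 κ.C))⁻¹ *
    (toTM (Matrix.fromBlocks 0 P.B₂ κ.B 0) * toTM E)
  have hreal : realize (Matrix.fromBlocks P.A 0 0 κ.A) (Matrix.fromBlocks 0 P.B₂ κ.B 0)
      (Matrix.fromBlocks P.C₂ 0 0 κ.C) (Matrix.fromBlocks 0 P.D₂₂ κ.D 0) =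
      Matrix.fromBlocks 0 P.P₂₂ K 0 := by
    rw [hKdef, P₂₂, transfer_eq_realize, transfer_eq_realize]
    simp only [realize, HasSchurRealization.pencil_fromBlocks_diag_inv, toTM_fromBlocks,
      Matrix.fromBlocks_multiply, Matrix.fromBlocks_add, toTM_zero, Matrix.mul_zero,
      Matrix.zero_mul, add_zero, zero_add]
  rw [hreal, one_sub_fromBlocks_zero] at hinv
  have hinv' := mul_eq_one_comm.mp hinv
  rw [← Matrix.fromBlocks_toBlocks N, Matrix.fromBlocks_multiply, ← Matrix.fromBlocks_one,
    Matrix.fromBlocks_inj] at hinv hinv'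
  simp only [Matrix.one_mul, Matrix.mul_one, Matrix.neg_mul, Matrix.mul_neg] at hinv hinv'
  obtain ⟨a1, a2, a3, a4⟩ := hinv
  obtain ⟨b1, b2, b3, b4⟩ := hinv'
  refine ⟨(N.toBlocks₁₁, N.toBlocks₂₁, N.toBlocks₁₂, N.toBlocks₂₂), ?_, ?_, ?_⟩
  · rw [mem_iopSubspace_iff]
    simp only [IOParam.Y, IOParam.U, IOParam.W, IOParam.Z]
    refine ⟨⟨?_, ?_, ?_, ?_⟩, fun i j => hN _ _, fun i j => hN _ _, fun i j => hN _ _,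
      fun i j => hN _ _⟩
    · rw [← a1]; abel
    · rw [← sub_eq_zero, ← a2]; abel
    · rw [← sub_eq_zero, ← b2]; abel
    · rw [← b4]; abel
  · simp only [IOParam.Y, IOParam.U]
    rw [← sub_eq_zero, ← a3]; abel
  · simp only [IOParam.Y]
    have hW : N.toBlocks₁₂ = N.toBlocks₁₁ * P.P₂₂ := by rw [← sub_eq_zero, ← b2]; abel
    rw [Matrix.mul_sub, Matrix.mul_one, ← Matrix.mul_assoc, ← hW, ← b1]; abel

end Plant

/-! ### Quadratic invariance and the map `K ↦ K (1 - G K)⁻¹`. -/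

section Invariance

variable {nu ny : ℕ} {L : Submodule ℝ (TransferMatrix nu ny)} {G : TransferMatrix ny nu}
  {K : TransferMatrix nu ny}

theorem QuadraticallyInvariant.neg (hQI : QuadraticallyInvariant L G) :
    QuadraticallyInvariant L (-G) := by
  intro K hK
  rw [Matrix.mul_neg, Matrix.neg_mul]
  exact L.neg_mem (hQI K hK)

/-- Polarization of the quadratic map `K ↦ K * G * K`. -/
theorem QuadraticallyInvariant.add_mem (hQI : QuadraticallyInvariant L G)
    {S T : TransferMatrix nu ny} (hS : S ∈ L) (hT : T ∈ L) : S * G * T + T * G * S ∈ L := by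
  have h := L.sub_mem (L.sub_mem (hQI _ (L.add_mem hS hT)) (hQI S hS)) (hQI T hT)
  convert h using 1
  simp only [Matrix.add_mul, Matrix.mul_add]
  abel

/-- For `S = K (1 - G K) ^ i` and `T = K` the two polarized products coincide, because `G K`
commutes with `1 - G K`; halving their sum gives `S * G * K ∈ L`. -/
theorem QuadraticallyInvariant.mul_pow_mem (hQI : QuadraticallyInvariant L G) (hK : K ∈ L)
    (i : ℕ) : K * (1 - G * K) ^ i ∈ L := by
  induction i with
  | zero => simpa using hK
  | succ i ih =>
    have hcomm : Commute (G * K) ((1 - G * K) ^ i) :=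
      ((Commute.one_right _).sub_right (Commute.refl _)).pow_right i
    have h1 : K * (1 - G * K) ^ i * G * K = K * G * (K * (1 - G * K) ^ i) := by
      simp only [Matrix.mul_assoc]
      rw [← Matrix.mul_assoc G K, hcomm.eq]
    have h2 := hQI.add_mem ih hK
    rw [h1] at h2
    have h3 := L.smul_mem (1 / 2 : ℝ) h2
    rw [← two_smul ℝ, smul_smul, one_div, inv_mul_cancel₀ two_ne_zero, one_smul, ← h1] at h3
    have h4 := L.sub_mem ih h3
    rwa [pow_succ, Matrix.mul_sub, Matrix.mul_one, Matrix.mul_sub, ← Matrix.mul_assoc,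
      ← Matrix.mul_assoc]

theorem QuadraticallyInvariant.mul_aeval_mem (hQI : QuadraticallyInvariant L G) (hK : K ∈ L)
    (p : Polynomial ℝ) : K * Polynomial.aeval (1 - G * K) p ∈ L := by
  rw [Polynomial.aeval_eq_sum_range, Matrix.mul_sum]
  refine L.sum_mem fun i _ => ?_
  rw [Matrix.mul_smul]
  exact L.smul_mem _ (hQI.mul_pow_mem hK i)

open Polynomial in
/-- An invertible real matrix is annihilated by a polynomial with constant coefficient `1`. -/
theorem exists_aeval_eq_zero {α : Type*} [Fintype α] [DecidableEq α] {D : Matrix α α ℝ}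
    (hD : IsUnit D) : ∃ p : ℝ[X], p.coeff 0 = 1 ∧ aeval D p = 0 := by
  have hdet : D.det ≠ 0 := ((Matrix.isUnit_iff_isUnit_det _).mp hD).ne_zero
  have h0 : D.charpoly.coeff 0 ≠ 0 := by
    intro h
    apply hdet
    rw [Matrix.det_eq_sign_charpoly_coeff, h, mul_zero]
  refine ⟨C (D.charpoly.coeff 0)⁻¹ * D.charpoly, ?_, ?_⟩
  · rw [coeff_C_mul, inv_mul_cancel₀ h0]
  · rw [map_mul, Matrix.aeval_self_charpoly, mul_zero]

open Polynomial in
/-- A response-closed quadratically invariant subspace is invariant under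
`K ↦ K (1 - G K)⁻¹`. -/
theorem QuadraticallyInvariant.mul_inv_mem (hQI : QuadraticallyInvariant L G)
    (hL : IsResponseClosed L) (hK : K ∈ L) (hKp : EntriesIn properAlg K)
    (hGp : EntriesIn properAlg G) {N : TransferMatrix ny ny} (hN : (1 - G * K) * N = 1)
    (hNp : EntriesIn properAlg N) : K * N ∈ L := by
  have hN' : N * (1 - G * K) = 1 := mul_eq_one_comm.mp hN
  set M := 1 - G * K with hM
  obtain ⟨D, hD⟩ := HasFeedthrough.exists_of_proper (EntriesIn.one.sub (hGp.mul hKp))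
  have hMi : M⁻¹ = N := Matrix.inv_eq_right_inv hN
  have hDu : IsUnit D := hD.isUnit_of_inv_proper (IsUnit.of_mul_eq_one _ hN) (by
    rw [← hM, hMi]; exact hNp)
  -- A Neumann series in `G K` need not converge at infinity when `G` has a direct term. Instead,
  -- Cayley–Hamilton gives `p` with `p(0) = 1` and `p(D) = 0`, so `p(M)` vanishes at infinity and
  -- `p(M) ^ k` is of order `z⁻ᵏ`.
  obtain ⟨p, hp0, hp⟩ := exists_aeval_eq_zero hDu
  have hE : EntriesIn properAlg ((RatFunc.X : RatFunc ℝ) • aeval M p) := by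
    have := (hD.aeval p).X_smul
    rwa [hp, toTM_zero, sub_zero] at this
  -- The polynomial `(1 - p ^ k) / X` evaluated at `M` is `N (1 - p(M) ^ k)`, so the approximation
  -- error is `K N p(M) ^ k`.
  refine hL _ (hKp.mul hNp) fun k => ⟨K * aeval M (divX (1 - p ^ k)), hQI.mul_aeval_mem hK _, ?_⟩
  have hg : X * divX (1 - p ^ k) = 1 - p ^ k := by
    have h0 : (1 - p ^ k).coeff 0 = 0 := by
      rw [coeff_sub, coeff_one_zero, coeff_zero_eq_eval_zero, eval_pow, ← coeff_zero_eq_eval_zero,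
        hp0, one_pow, sub_self]
    have := X_mul_divX_add (1 - p ^ k)
    rwa [h0, C_0, add_zero] at this
  have hg' : aeval M (divX (1 - p ^ k)) = N * (1 - aeval M p ^ k) := by
    have := congrArg (aeval M) hg
    rw [map_mul, aeval_X, map_sub, map_one, map_pow] at this
    rw [← this, ← Matrix.mul_assoc, hN', Matrix.one_mul]
  have hfin : (RatFunc.X : RatFunc ℝ) ^ k • (K * N - K * aeval M (divX (1 - p ^ k))) =
      K * N * ((RatFunc.X : RatFunc ℝ) • aeval M p) ^ k := by
    rw [hg', _root_.smul_pow, Matrix.mul_smul]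
    congr 1
    rw [Matrix.mul_sub, Matrix.mul_one, Matrix.mul_sub, sub_sub_cancel, Matrix.mul_assoc]
  rw [hfin]
  exact (hKp.mul hNp).mul (hE.pow k)

end Invariance

/-! ### Resolvent identities and stability of the maps through the plant state. -/

theorem pencil_inv_eq_sub {ι : Type*} [Fintype ι] [DecidableEq ι] (A E : Matrix ι ι ℝ) :
    (pencil A)⁻¹ = (pencil (A + E))⁻¹ - (pencil A)⁻¹ * toTM E * (pencil (A + E))⁻¹ := by
  have hp : pencil A = pencil (A + E) + toTM E := by
    simp only [pencil, toTM_add]; abel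
  have h : (pencil A)⁻¹ * pencil A * (pencil (A + E))⁻¹ =
      (pencil A)⁻¹ + (pencil A)⁻¹ * toTM E * (pencil (A + E))⁻¹ := by
    conv_lhs => enter [1, 2]; rw [hp]
    rw [Matrix.mul_add, Matrix.add_mul, Matrix.mul_assoc _ (pencil (A + E)), pencil_mul_inv,
      Matrix.mul_one]
  rw [inv_mul_pencil, Matrix.one_mul] at h
  exact eq_sub_of_add_eq h.symm

theorem pencil_inv_eq_sub' {ι : Type*} [Fintype ι] [DecidableEq ι] (A E : Matrix ι ι ℝ) :
    (pencil A)⁻¹ = (pencil (A + E))⁻¹ - (pencil (A + E))⁻¹ * toTM E * (pencil A)⁻¹ := by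
  have hp : pencil A = pencil (A + E) + toTM E := by
    simp only [pencil, toTM_add]; abel
  have h : (pencil (A + E))⁻¹ * (pencil A * (pencil A)⁻¹) =
      (pencil A)⁻¹ + (pencil (A + E))⁻¹ * toTM E * (pencil A)⁻¹ := by
    conv_lhs => enter [2, 1]; rw [hp]
    rw [Matrix.add_mul, Matrix.mul_add, ← Matrix.mul_assoc, inv_mul_pencil, Matrix.one_mul,
      Matrix.mul_assoc]
  rw [pencil_mul_inv, Matrix.mul_one] at h
  exact eq_sub_of_add_eq h.symm

namespace Plant

variable {n nw nu nz ny : ℕ} (P : Plant n nw nu nz ny)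

theorem P₂₂_eq : P.P₂₂ = toTM P.C₂ * (pencil P.A)⁻¹ * toTM P.B₂ + toTM P.D₂₂ := rfl

/-- The closed-loop maps between the plant state and the loop signals are stable. -/
theorem entriesIn_state_maps {q : IOParam nu ny} (hq : q ∈ P.iopSubspace)
    (hstab : Stabilizable P.A P.B₂) (hdet : Detectable P.A P.C₂) :
    EntriesIn rhAlg (q.U * toTM P.C₂ * (pencil P.A)⁻¹) ∧
    EntriesIn rhAlg ((pencil P.A)⁻¹ * toTM P.B₂ * q.U) ∧
    EntriesIn rhAlg ((pencil P.A)⁻¹ +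
      (pencil P.A)⁻¹ * toTM P.B₂ * q.U * toTM P.C₂ * (pencil P.A)⁻¹) := by
  obtain ⟨F, hF⟩ := hstab
  obtain ⟨H, hH⟩ := hdet
  rw [isSchur_iff] at hF hH
  obtain ⟨⟨eY, eW, -, eZ⟩, hY, hU, hW, hZ⟩ := P.mem_iopSubspace_iff.mp hq
  have iF := pencil_inv_eq_sub P.A (P.B₂ * F)
  have iH := pencil_inv_eq_sub' P.A (H * P.C₂)
  have sF := hF.entriesIn_pencil_inv
  have sH := hH.entriesIn_pencil_inv
  have eG := P.P₂₂_eq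
  rw [toTM_mul] at iF iH
  have hb := EntriesIn.const (R := rhAlg) P.B₂
  have hc := EntriesIn.const (R := rhAlg) P.C₂
  have hd := EntriesIn.const (R := rhAlg) P.D₂₂
  have hf := EntriesIn.const (R := rhAlg) F
  have hh := EntriesIn.const (R := rhAlg) H
  have one_y : EntriesIn rhAlg (1 : TransferMatrix ny ny) := EntriesIn.one
  have one_u : EntriesIn rhAlg (1 : TransferMatrix nu nu) := EntriesIn.one
  generalize (pencil (P.A + P.B₂ * F))⁻¹ = ΦF at *
  generalize (pencil (P.A + H * P.C₂))⁻¹ = ΦH at *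
  generalize (pencil P.A)⁻¹ = Φ at *
  generalize toTM P.B₂ = b at *
  generalize toTM P.C₂ = c at *
  generalize toTM P.D₂₂ = d at *
  generalize toTM F = f at *
  generalize toTM H = h at *
  generalize q.Y = Y at *
  generalize q.U = U at *
  generalize q.Z = Z at *
  generalize q.W = W at *
  generalize P.P₂₂ = G at *
  -- Products of `U` with `c Φ b` on either side are stable, since they reduce to `Y, U, W, Z` and
  -- constants. The resolvent identities then replace an outer `Φ` by the stable `ΦF` or `ΦH`,
  -- leaving only such products.
  have eG0 : c * Φ * b = G - d := by rw [eG, add_sub_cancel_right]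
  have h1 : U * (c * Φ * b) = Z - 1 - U * d := by
    rw [eG0, eZ, Matrix.mul_sub]; abel
  have h2 : (c * Φ * b) * U = Y - 1 - d * U := by
    rw [eG0, eY, Matrix.sub_mul]; abel
  have h3 : c * Φ * b + (c * Φ * b) * U * (c * Φ * b) =
      W - d - d * (Z - 1) - (Y - 1) * d + d * U * d := by
    rw [eG0, eW, eZ, eY]
    simp only [Matrix.mul_sub, Matrix.sub_mul, Matrix.mul_add, Matrix.add_mul, Matrix.mul_one,
      Matrix.one_mul, ← Matrix.mul_assoc]
    abel
  have s1 : EntriesIn rhAlg (U * (c * Φ * b)) := by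
    rw [h1]; exact (hZ.sub one_u).sub (hU.mul hd)
  have s2 : EntriesIn rhAlg ((c * Φ * b) * U) := by
    rw [h2]; exact (hY.sub one_y).sub (hd.mul hU)
  have s3 : EntriesIn rhAlg (c * Φ * b + (c * Φ * b) * U * (c * Φ * b)) := by
    rw [h3]
    exact (((hW.sub hd).sub (hd.mul (hZ.sub one_u))).sub ((hY.sub one_y).mul hd)).add
      ((hd.mul hU).mul hd)
  have t1 : U * c * Φ = U * c * ΦF - U * (c * Φ * b) * f * ΦF := by
    conv_lhs => rw [iF]
    simp only [Matrix.mul_sub, ← Matrix.mul_assoc]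
  have t2 : Φ * b * U = ΦH * b * U - ΦH * h * ((c * Φ * b) * U) := by
    conv_lhs => rw [iH]
    simp only [Matrix.sub_mul, ← Matrix.mul_assoc]
  have t3 : Φ * b + Φ * b * U * (c * Φ * b) = ΦH * b + ΦH * b * (U * (c * Φ * b)) -
      ΦH * h * (c * Φ * b + (c * Φ * b) * U * (c * Φ * b)) := by
    have : Φ * b + Φ * b * U * (c * Φ * b) = Φ * (b + b * U * (c * Φ * b)) := by
      simp only [Matrix.mul_add, ← Matrix.mul_assoc]
    rw [this]
    conv_lhs => enter [1]; rw [iH]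
    simp only [Matrix.sub_mul, Matrix.mul_add, ← Matrix.mul_assoc]
    abel
  have t4 : Φ + Φ * b * U * c * Φ = ΦF + Φ * b * U * c * ΦF -
      (Φ * b + Φ * b * U * (c * Φ * b)) * f * ΦF := by
    have : Φ + Φ * b * U * c * Φ = (1 + Φ * b * U * c) * Φ := by
      rw [Matrix.add_mul, Matrix.one_mul]
    rw [this]
    conv_lhs => enter [2]; rw [iF]
    simp only [Matrix.mul_sub, Matrix.add_mul, Matrix.one_mul, ← Matrix.mul_assoc]
  have r1 : EntriesIn rhAlg (U * c * Φ) := by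
    rw [t1]; exact ((hU.mul hc).mul sF).sub ((s1.mul hf).mul sF)
  have r2 : EntriesIn rhAlg (Φ * b * U) := by
    rw [t2]; exact ((sH.mul hb).mul hU).sub ((sH.mul hh).mul s2)
  refine ⟨r1, r2, ?_⟩
  rw [t4, t3]
  exact (sF.add ((r2.mul hc).mul sF)).sub (((((sH.mul hb).add ((sH.mul hb).mul s1)).sub
    ((sH.mul hh).mul s3)).mul hf).mul sF)

/-- The closed-loop map belongs to `RH∞` on the affine subspace. -/
theorem entriesIn_iopClosedLoop {q : IOParam nu ny} (hq : q ∈ P.iopSubspace)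
    (hstab : Stabilizable P.A P.B₂) (hdet : Detectable P.A P.C₂) :
    EntriesIn rhAlg (P.iopClosedLoop q) := by
  obtain ⟨h1, h2, h3⟩ := P.entriesIn_state_maps hq hstab hdet
  obtain ⟨-, -, hU, -, -⟩ := P.mem_iopSubspace_iff.mp hq
  have e : P.iopClosedLoop q =
      toTM P.C₁ * ((pencil P.A)⁻¹ +
        (pencil P.A)⁻¹ * toTM P.B₂ * q.U * toTM P.C₂ * (pencil P.A)⁻¹) * toTM P.B₁ + toTM P.D₁₁ +
      toTM P.C₁ * ((pencil P.A)⁻¹ * toTM P.B₂ * q.U) * toTM P.D₂₁ +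
      toTM P.D₁₂ * (q.U * toTM P.C₂ * (pencil P.A)⁻¹) * toTM P.B₁ +
      toTM P.D₁₂ * q.U * toTM P.D₂₁ := by
    simp only [iopClosedLoop, P₁₁, P₁₂, P₂₁, transfer_eq_realize, realize, Matrix.mul_add,
      Matrix.add_mul, ← Matrix.mul_assoc]
    abel
  rw [e]
  exact (((((EntriesIn.const _).mul h3).mul (EntriesIn.const _)).add (EntriesIn.const _)).add
    (((EntriesIn.const _).mul h2).mul (EntriesIn.const _))).add
    (((EntriesIn.const _).mul h1).mul (EntriesIn.const _)) |>.add
    (((EntriesIn.const _).mul hU).mul (EntriesIn.const _))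

end Plant

/-! ### Observers with a parameter `Q`, and the algebraic loop through `D`. -/

section Observer

variable {ι α β : Type*} [Fintype α] [Fintype β] {A : Matrix ι ι ℝ} {Bu : Matrix ι α ℝ} {Be : Matrix ι β ℝ} {C : Matrix β ι ℝ}
  {F : Matrix α ι ℝ} {Q : Matrix α β ℝ} {D : Matrix β α ℝ} {J : Matrix α α ℝ}

/-- State matrix of the system `s⁺ = A s + Bu u + Be e`, `u = F s + Q e` driven by `y`, where
`e = y - C s - D u` and `J` is the inverse of `1 + Q D`. -/
def observerA (A : Matrix ι ι ℝ) (Bu : Matrix ι α ℝ) (Be : Matrix ι β ℝ) (C : Matrix β ι ℝ)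
    (F : Matrix α ι ℝ) (Q : Matrix α β ℝ) (D : Matrix β α ℝ) (J : Matrix α α ℝ) : Matrix ι ι ℝ :=
  A - Be * C + (Bu - Be * D) * (J * (F - Q * C))

/-- Input matrix of the system `s⁺ = A s + Bu u + Be e`, `u = F s + Q e` driven by `y`. -/
def observerB (Bu : Matrix ι α ℝ) (Be : Matrix ι β ℝ) (Q : Matrix α β ℝ) (D : Matrix β α ℝ)
    (J : Matrix α α ℝ) : Matrix ι β ℝ :=
  Be + (Bu - Be * D) * (J * Q)

/-- Driving the observer with `y = C s + D F s` makes `e = 0` and `u = F s`, which leaves pure state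
feedback. This gives stabilizability of the controller. -/
theorem observerA_add_observerB_mul [DecidableEq α] (hJ : J * (1 + Q * D) = 1) :
    observerA A Bu Be C F Q D J + observerB Bu Be Q D J * (C + D * F) = A + Bu * F := by
  have h : J * (F - Q * C) + J * Q * (C + D * F) = F := by
    have : J * (F - Q * C) + J * Q * (C + D * F) = J * (1 + Q * D) * F := by
      simp only [Matrix.mul_sub, Matrix.mul_add, Matrix.add_mul, Matrix.mul_one, ← Matrix.mul_assoc]
      abel
    rw [this, hJ, Matrix.one_mul]
  have h' : observerA A Bu Be C F Q D J + observerB Bu Be Q D J * (C + D * F) =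
      A + Be * D * F + (Bu - Be * D) * (J * (F - Q * C) + J * Q * (C + D * F)) := by
    simp only [observerA, observerB, Matrix.mul_add, Matrix.add_mul, ← Matrix.mul_assoc]
    abel
  rw [h', h, Matrix.sub_mul]
  abel

/-- Injecting the output cancels the contribution of `u` to the state. This gives detectability of
the controller. -/
theorem observerA_add_mul :
    observerA A Bu Be C F Q D J + (Be * D - Bu) * (J * (F - Q * C)) = A - Be * C := by
  rw [observerA, ← neg_sub Bu, Matrix.neg_mul]
  abel

theorem observer_output [Fintype ι] [DecidableEq α] (hJ : (1 + Q * D) * J = 1) {s : ι → ℝ} {u : α → ℝ} {y : β → ℝ}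
    (hu : u = (J * (F - Q * C)).mulVec s + (J * Q).mulVec y) :
    u = F.mulVec s + Q.mulVec (y - C.mulVec s - D.mulVec u) := by
  have h : (1 + Q * D).mulVec u = (F - Q * C).mulVec s + Q.mulVec y := by
    rw [hu, Matrix.mulVec_add, Matrix.mulVec_mulVec, Matrix.mulVec_mulVec, ← Matrix.mul_assoc,
      ← Matrix.mul_assoc, hJ, Matrix.one_mul, Matrix.one_mul]
  rw [Matrix.add_mulVec, Matrix.one_mulVec, Matrix.sub_mulVec, ← eq_sub_iff_add_eq] at h
  simp only [Matrix.mulVec_sub, Matrix.mulVec_mulVec]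
  conv_lhs => rw [h]
  abel

theorem observer_state [Fintype ι] {s s' : ι → ℝ} {u : α → ℝ} {y : β → ℝ}
    (hu : u = (J * (F - Q * C)).mulVec s + (J * Q).mulVec y)
    (hs : s' = (observerA A Bu Be C F Q D J).mulVec s + (observerB Bu Be Q D J).mulVec y) :
    s' = A.mulVec s + Bu.mulVec u + Be.mulVec (y - C.mulVec s - D.mulVec u) := by
  have h : s' = A.mulVec s - (Be * C).mulVec s + Be.mulVec y +
      (Bu - Be * D).mulVec ((J * (F - Q * C)).mulVec s + (J * Q).mulVec y) := by
    rw [hs, observerA, observerB]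
    simp only [Matrix.add_mulVec, Matrix.sub_mulVec, Matrix.mulVec_add, Matrix.mulVec_mulVec]
    abel
  rw [h, ← hu]
  simp only [Matrix.sub_mulVec, Matrix.mulVec_sub, Matrix.mulVec_mulVec]
  abel

/-- Here `σ` and `e` are the transfer matrices from `y` to the state and to the innovation; the
identities are the implicit observer equations in the frequency domain. -/
theorem observer_transfer [Fintype ι] [DecidableEq ι] [DecidableEq α] [DecidableEq β]
    (hJ : (1 + Q * D) * J = 1) :
    ∃ (σ : Matrix ι β (RatFunc ℝ)) (e : Matrix β β (RatFunc ℝ)),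
      e = 1 - toTM C * σ - toTM D * realize (observerA A Bu Be C F Q D J) (observerB Bu Be Q D J)
        (J * (F - Q * C)) (J * Q) ∧
      realize (observerA A Bu Be C F Q D J) (observerB Bu Be Q D J) (J * (F - Q * C)) (J * Q) =
        toTM F * σ + toTM Q * e ∧
      σ = (pencil A)⁻¹ * (toTM Bu * realize (observerA A Bu Be C F Q D J) (observerB Bu Be Q D J)
        (J * (F - Q * C)) (J * Q) + toTM Be * e) := by
  have hJ' : (1 + toTM Q * toTM D) * toTM J = 1 := by
    rw [← toTM_one, ← toTM_mul, ← toTM_add, ← toTM_mul, hJ]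
  have hσ := pencil_mul_inv (observerA A Bu Be C F Q D J)
  have hK : realize (observerA A Bu Be C F Q D J) (observerB Bu Be Q D J) (J * (F - Q * C)) (J * Q) =
      toTM J * (toTM F - toTM Q * toTM C) * ((pencil (observerA A Bu Be C F Q D J))⁻¹ *
        toTM (observerB Bu Be Q D J)) + toTM J * toTM Q := by
    simp only [realize, toTM_mul, toTM_sub, Matrix.mul_assoc]
  set K := realize (observerA A Bu Be C F Q D J) (observerB Bu Be Q D J) (J * (F - Q * C)) (J * Q)
  set Ψ := (pencil (observerA A Bu Be C F Q D J))⁻¹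
  set σ := Ψ * toTM (observerB Bu Be Q D J) with hσdef
  have hσ' : pencil (observerA A Bu Be C F Q D J) * σ = toTM (observerB Bu Be Q D J) := by
    rw [hσdef, ← Matrix.mul_assoc, hσ, Matrix.one_mul]
  refine ⟨σ, 1 - toTM C * σ - toTM D * K, rfl, ?_, ?_⟩
  · have h : (1 + toTM Q * toTM D) * K = (toTM F - toTM Q * toTM C) * σ + toTM Q := by
      rw [hK, Matrix.mul_add, Matrix.mul_assoc (toTM J), ← Matrix.mul_assoc _ (toTM J),
        ← Matrix.mul_assoc _ (toTM J), hJ', Matrix.one_mul, Matrix.one_mul]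
    rw [Matrix.add_mul, Matrix.one_mul, ← eq_sub_iff_add_eq] at h
    simp only [Matrix.mul_sub, Matrix.mul_one, ← Matrix.mul_assoc]
    conv_lhs => rw [h]
    simp only [Matrix.sub_mul]
    abel
  · have hp : pencil (observerA A Bu Be C F Q D J) = pencil A + toTM Be * toTM C -
        (toTM Bu - toTM Be * toTM D) * (toTM J * (toTM F - toTM Q * toTM C)) := by
      simp only [pencil, observerA, toTM_add, toTM_sub, toTM_mul]
      abel
    have hB : toTM (observerB Bu Be Q D J) = toTM Be +
        (toTM Bu - toTM Be * toTM D) * (toTM J * toTM Q) := by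
      simp only [observerB, toTM_add, toTM_sub, toTM_mul]
    have h : pencil A * σ = toTM Bu * K + toTM Be * (1 - toTM C * σ - toTM D * K) := by
      rw [hp, hB, Matrix.sub_mul, sub_eq_iff_eq_add, Matrix.add_mul, ← eq_sub_iff_add_eq] at hσ'
      have h4 : toTM Bu * K + toTM Be * (1 - toTM C * σ - toTM D * K) =
          toTM Be - toTM Be * toTM C * σ + (toTM Bu - toTM Be * toTM D) * K := by
        simp only [Matrix.mul_sub, Matrix.sub_mul, Matrix.mul_one, ← Matrix.mul_assoc]
        abel
      rw [hσ', h4, hK, Matrix.mul_add]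
      simp only [← Matrix.mul_assoc]
      abel
    rw [← h, ← Matrix.mul_assoc, inv_mul_pencil, Matrix.one_mul]

end Observer

section ObserverRealization

variable {n k nu ny : ℕ}

/-- The state-space controller with an arbitrary finite state index reindexed by `Fin`. -/
def Controller.reindex {ι : Type*} (e : Fin k ≃ ι) (A : Matrix ι ι ℝ) (B : Matrix ι (Fin ny) ℝ)
    (C : Matrix (Fin nu) ι ℝ) (D : Matrix (Fin nu) (Fin ny) ℝ) : Controller k nu ny where
  A := A.submatrix e e
  B := B.submatrix e id
  C := C.submatrix id e
  D := D

variable {ι : Type*} [Fintype ι] {A : Matrix ι ι ℝ}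

theorem stabilizable_submatrix {B : Matrix ι (Fin ny) ℝ} (e : Fin k ≃ ι)
    (F : Matrix (Fin ny) ι ℝ) (h : SchurStable (A + B * F)) :
    Stabilizable (A.submatrix e e) (B.submatrix e id) := by
  refine ⟨F.submatrix id e, ?_⟩
  rw [isSchur_iff]
  exact h.submatrix e

theorem detectable_submatrix {C : Matrix (Fin nu) ι ℝ} (e : Fin k ≃ ι)
    (H : Matrix ι (Fin nu) ℝ) (h : SchurStable (A + H * C)) :
    Detectable (A.submatrix e e) (C.submatrix id e) := by
  refine ⟨H.submatrix e id, ?_⟩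
  rw [isSchur_iff]
  exact h.submatrix e

end ObserverRealization

/-! ### The observer-based controller realizes `U Y⁻¹` and stabilizes the plant. -/

namespace Plant

variable {n nw nu nz ny k : ℕ} (P : Plant n nw nu nz ny)

/-- The observer-based controller built from a state feedback `F`, an output injection `H` and a
stable parameter with realization `(Aq, Bq, Cq, Dq)`. -/
def observerController (F : Matrix (Fin nu) (Fin n) ℝ) (H : Matrix (Fin n) (Fin ny) ℝ)
    (Aq : Matrix (Fin k) (Fin k) ℝ) (Bq : Matrix (Fin k) (Fin ny) ℝ)
    (Cq : Matrix (Fin nu) (Fin k) ℝ) (Dq : Matrix (Fin nu) (Fin ny) ℝ)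
    (J : Matrix (Fin nu) (Fin nu) ℝ) : Controller (n + k) nu ny :=
  Controller.reindex finSumFinEquiv.symm
    (observerA (Matrix.fromBlocks P.A 0 0 Aq) (Matrix.fromRows P.B₂ 0) (Matrix.fromRows (-H) Bq)
      (Matrix.fromCols P.C₂ 0) (Matrix.fromCols F Cq) Dq P.D₂₂ J)
    (observerB (Matrix.fromRows P.B₂ 0) (Matrix.fromRows (-H) Bq) Dq P.D₂₂ J)
    (J * (Matrix.fromCols F Cq - Dq * Matrix.fromCols P.C₂ 0)) (J * Dq)

variable {F : Matrix (Fin nu) (Fin n) ℝ} {H : Matrix (Fin n) (Fin ny) ℝ}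
  {Aq : Matrix (Fin k) (Fin k) ℝ} {Bq : Matrix (Fin k) (Fin ny) ℝ}
  {Cq : Matrix (Fin nu) (Fin k) ℝ} {Dq : Matrix (Fin nu) (Fin ny) ℝ}
  {J : Matrix (Fin nu) (Fin nu) ℝ}

theorem schurStable_feedback (hF : SchurStable (P.A + P.B₂ * F)) (hA : SchurStable Aq) :
    SchurStable (Matrix.fromBlocks P.A 0 0 Aq + Matrix.fromRows P.B₂ 0 * Matrix.fromCols F Cq) := by
  rw [Matrix.fromRows_mul_fromCols, Matrix.fromBlocks_add]
  simp only [Matrix.zero_mul, add_zero]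
  exact hF.fromBlocks_zero₂₁ hA

theorem schurStable_injection (hH : SchurStable (P.A + H * P.C₂)) (hA : SchurStable Aq) :
    SchurStable (Matrix.fromBlocks P.A 0 0 Aq -
      Matrix.fromRows (-H) Bq * Matrix.fromCols P.C₂ 0) := by
  rw [Matrix.fromRows_mul_fromCols, sub_eq_add_neg, Matrix.fromBlocks_neg, Matrix.fromBlocks_add]
  simp only [Matrix.mul_zero, neg_zero, add_zero, Matrix.neg_mul, neg_neg]
  exact hH.fromBlocks_zero₁₂ hA

/-- Separation principle: the estimation error `ε` evolves autonomously under `A + H C₂` and drives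
a Schur stable system for the controller state, so the joint system is block triangular. -/
theorem internallyStable_observerController (hF : SchurStable (P.A + P.B₂ * F))
    (hH : SchurStable (P.A + H * P.C₂)) (hA : SchurStable Aq) (hJ : (1 + Dq * P.D₂₂) * J = 1) :
    P.InternallyStable (P.observerController F H Aq Bq Cq Dq J) := by
  refine ⟨?_, ?_⟩
  · change IsUnit (1 - P.D₂₂ * (J * Dq))
    have h2 : J * (1 + Dq * P.D₂₂) = 1 := mul_eq_one_comm.mp hJ
    have h3 : (1 - P.D₂₂ * (J * Dq)) * (1 + P.D₂₂ * Dq) = 1 := by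
      have : (1 - P.D₂₂ * (J * Dq)) * (1 + P.D₂₂ * Dq) =
          1 + P.D₂₂ * Dq - P.D₂₂ * (J * (1 + Dq * P.D₂₂)) * Dq := by
        simp only [Matrix.mul_add, Matrix.add_mul, Matrix.sub_mul, Matrix.mul_one, Matrix.one_mul,
          ← Matrix.mul_assoc]
        abel
      rw [this, h2, Matrix.mul_one, add_sub_cancel_right]
    exact IsUnit.of_mul_eq_one _ h3
  · intro x ξ u y htraj
    let s : ℕ → Fin n ⊕ Fin k → ℝ := fun t => ξ t ∘ finSumFinEquiv
    let ε : ℕ → Fin n → ℝ := fun t => x t - s t ∘ Sum.inl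
    have hu : ∀ t, u t = (J * (Matrix.fromCols F Cq - Dq * Matrix.fromCols P.C₂ 0)).mulVec (s t) +
        (J * Dq).mulVec (y t) := by
      intro t
      rw [(htraj t).2.2.2]
      simp only [observerController, Controller.reindex, Matrix.submatrix_mulVec_equiv]
      rfl
    have hs : ∀ t, s (t + 1) = (observerA (Matrix.fromBlocks P.A 0 0 Aq) (Matrix.fromRows P.B₂ 0)
        (Matrix.fromRows (-H) Bq) (Matrix.fromCols P.C₂ 0) (Matrix.fromCols F Cq) Dq P.D₂₂
        J).mulVec (s t) + (observerB (Matrix.fromRows P.B₂ 0) (Matrix.fromRows (-H) Bq) Dq P.D₂₂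
        J).mulVec (y t) := by
      intro t
      have h := (htraj t).2.2.1
      simp only [observerController, Controller.reindex, Matrix.submatrix_mulVec_equiv] at h
      ext i
      have := congrFun h (finSumFinEquiv i)
      simpa [s, Matrix.submatrix, Matrix.mulVec, dotProduct] using this
    have he : ∀ t, y t - (Matrix.fromCols P.C₂ 0).mulVec (s t) - P.D₂₂.mulVec (u t) =
        P.C₂.mulVec (ε t) := by
      intro t
      rw [(htraj t).2.1, Matrix.fromCols_mulVec, Matrix.zero_mulVec, add_zero, Matrix.mulVec_sub]
      abel
    have hu' := fun t => observer_output hJ (hu t)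
    have hs' := fun t => observer_state (hu t) (hs t)
    simp only [he] at hu' hs'
    have hε : ∀ t, ε (t + 1) = (P.A + H * P.C₂).mulVec (ε t) := by
      intro t
      have h1 : s (t + 1) ∘ Sum.inl = P.A.mulVec (s t ∘ Sum.inl) + P.B₂.mulVec (u t) -
          H.mulVec (P.C₂.mulVec (ε t)) := by
        rw [hs' t, Matrix.fromBlocks_mulVec, Matrix.fromRows_mulVec, Matrix.fromRows_mulVec]
        ext i
        simp [sub_eq_add_neg, Matrix.neg_mulVec]
      have h2 : ε (t + 1) = x (t + 1) - s (t + 1) ∘ Sum.inl := rfl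
      rw [h2, h1, (htraj t).1, Matrix.add_mulVec, ← Matrix.mulVec_mulVec]
      have h3 : P.A.mulVec (ε t) = P.A.mulVec (x t) - P.A.mulVec (s t ∘ Sum.inl) :=
        Matrix.mulVec_sub _ _ _
      rw [h3]
      abel
    have hs'' : ∀ t, s (t + 1) =
        ((Matrix.fromRows P.B₂ 0 * Dq + Matrix.fromRows (-H) Bq) * P.C₂).mulVec (ε t) +
        (Matrix.fromBlocks P.A 0 0 Aq +
          Matrix.fromRows P.B₂ 0 * Matrix.fromCols F Cq).mulVec (s t) := by
      intro t
      rw [hs' t, hu' t]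
      simp only [Matrix.add_mul, Matrix.add_mulVec, Matrix.mulVec_add, ← Matrix.mulVec_mulVec]
      abel
    let r : ℕ → Fin n ⊕ (Fin n ⊕ Fin k) → ℝ := fun t => Sum.elim (ε t) (s t)
    have hr : Filter.Tendsto r Filter.atTop (𝓝 0) := by
      refine (hH.fromBlocks_zero₁₂ (C := (Matrix.fromRows P.B₂ 0 * Dq + Matrix.fromRows (-H) Bq) *
        P.C₂) (P.schurStable_feedback (Cq := Cq) hF hA)).tendsto_zero fun t => ?_
      rw [Matrix.fromBlocks_mulVec]
      simp only [r]
      rw [hε t, hs'' t]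
      simp
    rw [tendsto_pi_nhds] at hr
    constructor
    · rw [tendsto_pi_nhds]
      intro i
      have := (hr (Sum.inl i)).add (hr (Sum.inr (Sum.inl i)))
      simpa [r, ε] using this
    · rw [tendsto_pi_nhds]
      intro i
      have := hr (Sum.inr (finSumFinEquiv.symm i))
      simpa [r, s] using this

/-- The transfer matrix of the observer-based controller, in terms of the parameter `Q`. -/
theorem transfer_observerController (hJ : (1 + Dq * P.D₂₂) * J = 1) {K : TransferMatrix nu ny}
    (hK : K = transfer (P.observerController F H Aq Bq Cq Dq J).A
      (P.observerController F H Aq Bq Cq Dq J).B (P.observerController F H Aq Bq Cq Dq J).C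
      (P.observerController F H Aq Bq Cq Dq J).D) :
    ∃ e : TransferMatrix ny ny,
      (1 - toTM P.C₂ * (pencil P.A)⁻¹ * toTM H) * e = 1 - P.P₂₂ * K ∧
      (1 - toTM F * (pencil P.A)⁻¹ * toTM P.B₂) * K =
        (realize Aq Bq Cq Dq - toTM F * (pencil P.A)⁻¹ * toTM H) * e := by
  rw [transfer_eq_realize] at hK
  simp only [observerController, Controller.reindex] at hK
  rw [realize_submatrix] at hK
  obtain ⟨σ, e, he, hKe, hσ⟩ := observer_transfer (A := Matrix.fromBlocks P.A 0 0 Aq)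
    (Bu := Matrix.fromRows P.B₂ 0) (Be := Matrix.fromRows (-H) Bq) (C := Matrix.fromCols P.C₂ 0)
    (F := Matrix.fromCols F Cq) hJ
  rw [← hK] at he hKe hσ
  have hσ' : σ = Matrix.fromRows
      ((pencil P.A)⁻¹ * toTM P.B₂ * K - (pencil P.A)⁻¹ * toTM H * e)
      ((pencil Aq)⁻¹ * toTM Bq * e) := by
    rw [hσ, HasSchurRealization.pencil_fromBlocks_diag_inv, toTM_fromRows, toTM_fromRows,
      Matrix.mul_add, ← Matrix.mul_assoc, ← Matrix.mul_assoc, Matrix.fromBlocks_mul_fromRows,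
      Matrix.fromBlocks_mul_fromRows, Matrix.fromRows_mul, Matrix.fromRows_mul]
    ext (i | i) j <;> simp [sub_eq_add_neg]
  have hC : toTM (Matrix.fromCols P.C₂ (0 : Matrix (Fin ny) (Fin k) ℝ)) * σ =
      toTM P.C₂ * (pencil P.A)⁻¹ * toTM P.B₂ * K - toTM P.C₂ * (pencil P.A)⁻¹ * toTM H * e := by
    rw [hσ', toTM_fromCols, Matrix.fromCols_mul_fromRows, toTM_zero, Matrix.zero_mul, add_zero]
    simp only [Matrix.mul_sub, ← Matrix.mul_assoc]
  have hF : toTM (Matrix.fromCols F Cq) * σ =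
      toTM F * (pencil P.A)⁻¹ * toTM P.B₂ * K - toTM F * (pencil P.A)⁻¹ * toTM H * e +
        toTM Cq * (pencil Aq)⁻¹ * toTM Bq * e := by
    rw [hσ', toTM_fromCols, Matrix.fromCols_mul_fromRows]
    simp only [Matrix.mul_sub, ← Matrix.mul_assoc]
  rw [hC] at he
  rw [hF] at hKe
  refine ⟨e, ?_, ?_⟩
  · rw [Matrix.sub_mul, Matrix.one_mul, P₂₂_eq, Matrix.add_mul, sub_eq_iff_eq_add]
    conv_lhs => rw [he]
    abel
  · rw [Matrix.sub_mul, Matrix.one_mul, sub_eq_iff_eq_add]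
    conv_lhs => rw [hKe]
    simp only [realize, Matrix.sub_mul, Matrix.add_mul]
    abel

theorem controller_mul_Y {q : IOParam nu ny} (h : IOParam.DefinesController q) :
    q.controller * q.Y = q.U := by
  rw [IOParam.controller, Matrix.mul_assoc,
    Matrix.nonsing_inv_mul _ ((Matrix.isUnit_iff_isUnit_det _).mp h.1), Matrix.mul_one]

/-- Multiply `Y = 1 + P₂₂ U` on the right by `Y⁻¹`. In particular `Y⁻¹` is proper as soon as `U Y⁻¹`
is. -/
theorem Y_inv_eq {q : IOParam nu ny} (hq : q ∈ P.iopSubspace) (h : IOParam.DefinesController q) :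
    (q.Y)⁻¹ = 1 - P.P₂₂ * q.controller := by
  have e := (P.mem_iopSubspace_iff.mp hq).1.1
  have h1 : q.Y * (q.Y)⁻¹ = 1 :=
    Matrix.mul_nonsing_inv _ ((Matrix.isUnit_iff_isUnit_det _).mp h.1)
  conv_lhs at h1 => enter [1]; rw [e]
  rw [Matrix.add_mul, Matrix.one_mul, Matrix.mul_assoc] at h1
  exact eq_sub_of_add_eq h1

theorem entriesIn_Y_inv {q : IOParam nu ny} (hq : q ∈ P.iopSubspace)
    (h : IOParam.DefinesController q) : EntriesIn properAlg (q.Y)⁻¹ := by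
  rw [P.Y_inv_eq hq h]
  exact EntriesIn.one.sub (P.hasFeedthrough_P₂₂.proper.mul h.2)

/-- Every controller defined by an element of the affine subspace is stabilizing. -/
theorem controller_mem_Cstab {q : IOParam nu ny} (hq : q ∈ P.iopSubspace)
    (hstab : Stabilizable P.A P.B₂) (hdet : Detectable P.A P.C₂)
    (h : IOParam.DefinesController q) : q.controller ∈ P.Cstab := by
  obtain ⟨s1, s2, s3⟩ := P.entriesIn_state_maps hq hstab hdet
  obtain ⟨F, hF⟩ := hstab
  obtain ⟨H, hH⟩ := hdet
  rw [isSchur_iff] at hF hH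
  obtain ⟨⟨eY, -, -, eZ⟩, -, hU, -, -⟩ := P.mem_iopSubspace_iff.mp hq
  obtain ⟨DU, hDU⟩ := HasFeedthrough.exists_of_proper (hU.mono inf_le_left)
  have hDY : HasFeedthrough q.Y (1 + P.D₂₂ * DU) := by
    rw [eY]; exact HasFeedthrough.one.add (P.hasFeedthrough_P₂₂.mul hDU)
  have hDYu := hDY.isUnit_of_inv_proper h.1 (P.entriesIn_Y_inv hq h)
  have hJu : IsUnit (1 + DU * P.D₂₂) := by
    rw [Matrix.isUnit_iff_isUnit_det] at hDYu ⊢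
    rwa [Matrix.det_one_add_mul_comm]
  obtain ⟨J, hJ⟩ := hJu.exists_right_inv
  -- This `Q` solves `Q - F Φ H = (1 - F Φ B₂) U (1 - C₂ Φ H)` with `Φ = (zI - A)⁻¹`. In the
  -- identities of `transfer_observerController` it yields `K = U (1 - P₂₂ K)` after cancelling `1 -
  -- F Φ B₂`.
  set Q : TransferMatrix nu ny := toTM F * (pencil P.A)⁻¹ * toTM H +
    (1 - toTM F * (pencil P.A)⁻¹ * toTM P.B₂) * q.U *
      (1 - toTM P.C₂ * (pencil P.A)⁻¹ * toTM H) with hQ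
  have hQ' : Q = toTM F * ((pencil P.A)⁻¹ +
      (pencil P.A)⁻¹ * toTM P.B₂ * q.U * toTM P.C₂ * (pencil P.A)⁻¹) * toTM H + q.U -
      q.U * toTM P.C₂ * (pencil P.A)⁻¹ * toTM H -
      toTM F * ((pencil P.A)⁻¹ * toTM P.B₂ * q.U) := by
    rw [hQ]
    simp only [Matrix.mul_sub, Matrix.sub_mul, Matrix.mul_add, Matrix.add_mul, Matrix.mul_one,
      Matrix.one_mul, ← Matrix.mul_assoc]
    abel
  have hQs : EntriesIn rhAlg Q := by
    rw [hQ']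
    exact (((((EntriesIn.const F).mul s3).mul (EntriesIn.const H)).add hU).sub
      (s1.mul (EntriesIn.const H))).sub ((EntriesIn.const F).mul s2)
  have hΦ := hasFeedthrough_pencil_inv P.A
  -- The resolvent vanishes at infinity, so `Q` and `U` agree there, and `J` inverts `1 + Dq *
  -- P.D₂₂` for the realization of `Q`.
  have hQD : HasFeedthrough Q DU := by
    have := (((HasFeedthrough.const F).mul hΦ).mul (HasFeedthrough.const H)).add
      (((HasFeedthrough.one.sub (((HasFeedthrough.const F).mul hΦ).mul
        (HasFeedthrough.const P.B₂))).mul hDU).mul (HasFeedthrough.one.sub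
          (((HasFeedthrough.const P.C₂).mul hΦ).mul (HasFeedthrough.const H))))
    simpa only [Matrix.mul_zero, Matrix.zero_mul, zero_add, sub_zero, Matrix.one_mul,
      Matrix.mul_one] using this
  obtain ⟨k, Aq, Bq, Cq, Dq, hAq, hreal⟩ := HasSchurRealization.of_entriesIn hQs
  have hDq : Dq = DU := (hasFeedthrough_realize Aq Bq Cq Dq).unique (hreal ▸ hQD)
  subst hDq
  refine ⟨n + k, P.observerController F H Aq Bq Cq Dq J, ?_, ?_, ?_,
    P.internallyStable_observerController hF hH hAq hJ⟩
  · refine stabilizable_submatrix _ (Matrix.fromCols P.C₂ 0 + P.D₂₂ * Matrix.fromCols F Cq) ?_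
    rw [observerA_add_observerB_mul (mul_eq_one_comm.mp hJ)]
    exact P.schurStable_feedback hF hAq
  · refine detectable_submatrix _ (Matrix.fromRows (-H) Bq * P.D₂₂ - Matrix.fromRows P.B₂ 0) ?_
    rw [observerA_add_mul]
    exact P.schurStable_injection hH hAq
  · set K := transfer (P.observerController F H Aq Bq Cq Dq J).A
      (P.observerController F H Aq Bq Cq Dq J).B (P.observerController F H Aq Bq Cq Dq J).C
      (P.observerController F H Aq Bq Cq Dq J).D with hK
    obtain ⟨e, he, hKe⟩ := P.transfer_observerController hJ hK
    rw [hreal, hQ, add_sub_cancel_left, Matrix.mul_assoc _ _ e, he, Matrix.mul_assoc] at hKe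
    -- The return difference `1 - F Φ B₂` of the state feedback is inverted by means of the
    -- resolvent of `A + B₂ F`.
    have hleft : (1 + toTM F * (pencil (P.A + P.B₂ * F))⁻¹ * toTM P.B₂) *
        (1 - toTM F * (pencil P.A)⁻¹ * toTM P.B₂) = 1 := by
      apply mul_eq_one_comm.mp
      have i := pencil_inv_eq_sub P.A (P.B₂ * F)
      rw [toTM_mul] at i
      have : (1 - toTM F * (pencil P.A)⁻¹ * toTM P.B₂) *
          (1 + toTM F * (pencil (P.A + P.B₂ * F))⁻¹ * toTM P.B₂) = 1 + toTM F *
          ((pencil (P.A + P.B₂ * F))⁻¹ - (pencil P.A)⁻¹ * (toTM P.B₂ * toTM F) *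
            (pencil (P.A + P.B₂ * F))⁻¹ - (pencil P.A)⁻¹) * toTM P.B₂ := by
        simp only [Matrix.mul_sub, Matrix.sub_mul, Matrix.mul_add, Matrix.mul_one,
          Matrix.one_mul, ← Matrix.mul_assoc]
        abel
      rw [this, ← i, sub_self, Matrix.mul_zero, Matrix.zero_mul, add_zero]
    have hKU : K = q.U * (1 - P.P₂₂ * K) := by
      have := congrArg ((1 + toTM F * (pencil (P.A + P.B₂ * F))⁻¹ * toTM P.B₂) * ·) hKe
      simpa only [← Matrix.mul_assoc, hleft, Matrix.one_mul] using this
    have hYK : q.Y * (1 - P.P₂₂ * K) = 1 := by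
      rw [eY, Matrix.add_mul, Matrix.one_mul, Matrix.mul_assoc, ← hKU, sub_add_cancel]
    rw [IOParam.controller, Matrix.inv_eq_right_inv hYK, ← hKU]

end Plant

/-! ### Structured controllers, convexity, and density of the elements that define a controller. -/

open Polynomial in
/-- The determinant of an affine pencil through an invertible matrix vanishes at finitely many
points only. -/
theorem eventually_isUnit_combo {m : ℕ} {D D₀ : Matrix (Fin m) (Fin m) ℝ}
    (h : IsUnit D₀) : ∀ᶠ t : ℝ in 𝓝[≠] 0, IsUnit ((1 - t) • D + t • D₀) := by
  let M : Matrix (Fin m) (Fin m) ℝ[X] :=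
    ((1 - X : ℝ[X]) • D.map (C : ℝ →+* ℝ[X])) + (X : ℝ[X]) • D₀.map (C : ℝ →+* ℝ[X])
  have heval : ∀ t : ℝ, M.det.eval t = ((1 - t) • D + t • D₀).det := by
    intro t
    rw [← coe_evalRingHom, RingHom.map_det]
    congr 1
    ext i j
    simp [M, mul_comm t]
  -- At `t = 1` the determinant is that of `D₀`.
  have h0 : M.det ≠ 0 := by
    intro h0
    have h1 := heval 1
    rw [h0, eval_zero, sub_self, zero_smul, zero_add, one_smul] at h1
    exact ((Matrix.isUnit_iff_isUnit_det _).mp h).ne_zero h1.symm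
  have hfin : {t : ℝ | M.det.IsRoot t}.Finite := Polynomial.finite_setOfPred_isRoot h0
  have hev : ∀ᶠ t : ℝ in Filter.cofinite, ¬ M.det.IsRoot t := hfin.eventually_cofinite_notMem
  filter_upwards [nhdsNE_le_cofinite 0 hev] with t ht
  rw [Matrix.isUnit_iff_isUnit_det, isUnit_iff_ne_zero, ← heval]
  exact ht

namespace Plant

variable {n nw nu nz ny : ℕ} (P : Plant n nw nu nz ny) {L : Submodule ℝ (TransferMatrix nu ny)}

theorem hasFeedthrough_Y {q : IOParam nu ny} (hq : q ∈ P.iopSubspace) :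
    ∃ D, HasFeedthrough q.Y D :=
  HasFeedthrough.exists_of_proper
    ((P.mem_iopSubspace_iff.mp hq).2.1.mono inf_le_left)

theorem definesController_of_isUnit {q : IOParam nu ny} (hq : q ∈ P.iopSubspace)
    {D : Matrix (Fin ny) (Fin ny) ℝ} (hD : HasFeedthrough q.Y D) (hDu : IsUnit D) :
    IOParam.DefinesController q := by
  obtain ⟨h1, h2⟩ := hD.isUnit_of_isUnit hDu
  exact ⟨h1, ((P.mem_iopSubspace_iff.mp hq).2.2.1.mono inf_le_left).mul h2⟩

theorem isUnit_of_definesController {q : IOParam nu ny} (hq : q ∈ P.iopSubspace)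
    (h : IOParam.DefinesController q) {D : Matrix (Fin ny) (Fin ny) ℝ}
    (hD : HasFeedthrough q.Y D) : IsUnit D :=
  hD.isUnit_of_inv_proper h.1 (P.entriesIn_Y_inv hq h)

theorem definesController_of_strictlyProper {q : IOParam nu ny} (hq : q ∈ P.iopSubspace)
    (h0 : P.D₂₂ = 0) : IOParam.DefinesController q := by
  obtain ⟨⟨eY, -, -, -⟩, -, hU, -, -⟩ := P.mem_iopSubspace_iff.mp hq
  obtain ⟨DU, hDU⟩ := HasFeedthrough.exists_of_proper (hU.mono inf_le_left)
  have hDY : HasFeedthrough q.Y (1 + P.D₂₂ * DU) := by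
    rw [eY]; exact HasFeedthrough.one.add (P.hasFeedthrough_P₂₂.mul hDU)
  rw [h0, Matrix.zero_mul, add_zero] at hDY
  exact P.definesController_of_isUnit hq hDY isUnit_one

/-- Since `Y = 1 - (-P₂₂) U`, the map `U ↦ U Y⁻¹` is the one of `mul_inv_mem` for `-P₂₂`. -/
theorem controller_mem {q : IOParam nu ny} (hq : q ∈ P.iopFeasible L)
    (hclosed : IsResponseClosed L) (hQI : QuadraticallyInvariant L P.P₂₂)
    (h : IOParam.DefinesController q) : q.controller ∈ L := by
  obtain ⟨⟨eY, -, -, -⟩, hY, hU, -, -⟩ := P.mem_iopSubspace_iff.mp hq.1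
  have hN : (1 - -P.P₂₂ * q.U) * (q.Y)⁻¹ = 1 := by
    rw [Matrix.neg_mul, sub_neg_eq_add, ← eY]
    exact Matrix.mul_nonsing_inv _ ((Matrix.isUnit_iff_isUnit_det _).mp h.1)
  exact hQI.neg.mul_inv_mem hclosed hq.2 (hU.mono inf_le_left) P.hasFeedthrough_P₂₂.proper.neg hN
    (P.entriesIn_Y_inv hq.1 h)

theorem exists_mem_iopFeasible {K : TransferMatrix nu ny} (hK : K ∈ P.Cstab) (hKL : K ∈ L)
    (hclosed : IsResponseClosed L) (hQI : QuadraticallyInvariant L P.P₂₂) :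
    ∃ q ∈ P.iopFeasible L, IOParam.DefinesController q ∧ K = q.controller := by
  obtain ⟨hKp, q, hq, hU, hY⟩ := P.exists_mem_iopSubspace_of_mem_Cstab hK
  have hY' : (1 - P.P₂₂ * K) * q.Y = 1 := mul_eq_one_comm.mp hY
  have hYp : EntriesIn properAlg q.Y := (P.mem_iopSubspace_iff.mp hq).2.1.mono inf_le_left
  have hKc : K = q.controller := by
    rw [IOParam.controller, hU, Matrix.mul_assoc, Matrix.inv_eq_right_inv hY, hY, Matrix.mul_one]
  refine ⟨q, ⟨hq, ?_⟩, ⟨IsUnit.of_mul_eq_one _ hY, ?_⟩, hKc⟩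
  · rw [hU]
    exact hQI.mul_inv_mem hclosed hKL hKp P.hasFeedthrough_P₂₂.proper hY' hYp
  · rw [← hKc]; exact hKp

theorem closedLoop_controller {q : IOParam nu ny} (hq : q ∈ P.iopSubspace)
    (h : IOParam.DefinesController q) : P.closedLoop q.controller = P.iopClosedLoop q := by
  rw [closedLoop, ← P.Y_inv_eq hq h,
    Matrix.nonsing_inv_nonsing_inv _ ((Matrix.isUnit_iff_isUnit_det _).mp h.1),
    Matrix.mul_assoc P.P₁₂, controller_mul_Y h]
  rfl

/-- `K` determines `Y⁻¹ = 1 - P₂₂ K`, then `U = K Y`, and finally `W` and `Z`. -/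
theorem eq_of_controller_eq {q q' : IOParam nu ny} (hq : q ∈ P.iopSubspace)
    (hq' : q' ∈ P.iopSubspace) (h : IOParam.DefinesController q)
    (h' : IOParam.DefinesController q') (he : q.controller = q'.controller) : q = q' := by
  have hYi : (q.Y)⁻¹ = (q'.Y)⁻¹ := by rw [P.Y_inv_eq hq h, P.Y_inv_eq hq' h', he]
  have hY : q.Y = q'.Y := Matrix.inv_inj hYi ((Matrix.isUnit_iff_isUnit_det _).mp h.1)
  have hU : q.U = q'.U := by rw [← controller_mul_Y h, ← controller_mul_Y h', he, hY]
  obtain ⟨-, -, eW, eZ⟩ := (P.mem_iopSubspace_iff.mp hq).1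
  obtain ⟨-, -, eW', eZ'⟩ := (P.mem_iopSubspace_iff.mp hq').1
  have hW : q.W = q'.W := by rw [eW, eW', hY]
  have hZ : q.Z = q'.Z := by rw [eZ, eZ', hU]
  exact Prod.ext hY (Prod.ext hU (Prod.ext hW hZ))

theorem convex_iopFeasible : Convex ℝ (P.iopFeasible L) := by
  intro q hq q' hq' a b _ _ hab
  obtain ⟨⟨eY, eW, eW', eZ⟩, hY, hU, hW, hZ⟩ := P.mem_iopSubspace_iff.mp hq.1
  obtain ⟨⟨fY, fW, fW', fZ⟩, gY, gU, gW, gZ⟩ := P.mem_iopSubspace_iff.mp hq'.1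
  have h1 : ∀ {m : ℕ}, (1 : TransferMatrix m m) = a • 1 + b • 1 := fun {m} => by
    rw [← add_smul, hab, one_smul]
  refine ⟨P.mem_iopSubspace_iff.mpr ⟨⟨?_, ?_, ?_, ?_⟩, (hY.smul_real a).add (gY.smul_real b),
    (hU.smul_real a).add (gU.smul_real b), (hW.smul_real a).add (gW.smul_real b),
    (hZ.smul_real a).add (gZ.smul_real b)⟩,
    L.add_mem (L.smul_mem a hq.2) (L.smul_mem b hq'.2)⟩
  · change a • q.Y + b • q'.Y = 1 + P.P₂₂ * (a • q.U + b • q'.U)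
    rw [eY, fY, Matrix.mul_add, Matrix.mul_smul, Matrix.mul_smul, smul_add, smul_add]
    conv_rhs => rw [h1]
    abel
  · change a • q.W + b • q'.W = P.P₂₂ * (a • q.Z + b • q'.Z)
    rw [eW, fW, Matrix.mul_add, Matrix.mul_smul, Matrix.mul_smul]
  · change a • q.W + b • q'.W = (a • q.Y + b • q'.Y) * P.P₂₂
    rw [eW', fW', Matrix.add_mul, Matrix.smul_mul, Matrix.smul_mul]
  · change a • q.Z + b • q'.Z = 1 + (a • q.U + b • q'.U) * P.P₂₂
    rw [eZ, fZ, Matrix.add_mul, Matrix.smul_mul, Matrix.smul_mul, smul_add, smul_add]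
    conv_rhs => rw [h1]
    abel

theorem iopClosedLoop_combo (q q' : IOParam nu ny) {a b : ℝ} (hab : a + b = 1) :
    P.iopClosedLoop (a • q + b • q') = a • P.iopClosedLoop q + b • P.iopClosedLoop q' := by
  have h1 : P.P₁₁ = a • P.P₁₁ + b • P.P₁₁ := by rw [← add_smul, hab, one_smul]
  change P.P₁₁ + P.P₁₂ * (a • q.U + b • q'.U) * P.P₂₁ = _
  conv_lhs => rw [h1]
  simp only [iopClosedLoop, Matrix.mul_add, Matrix.add_mul, Matrix.mul_smul, Matrix.smul_mul,
    smul_add]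
  abel

theorem convexOn_iopClosedLoop (hstab : Stabilizable P.A P.B₂) (hdet : Detectable P.A P.C₂)
    {ν : TransferMatrix nz nw → ℝ} (hν : IsSeminormOnRHinf ν) :
    ConvexOn ℝ (P.iopFeasible L) (fun q => ν (P.iopClosedLoop q)) := by
  refine ⟨P.convex_iopFeasible, fun q hq q' hq' a b ha hb hab => ?_⟩
  have h := P.entriesIn_iopClosedLoop hq.1 hstab hdet
  have h' := P.entriesIn_iopClosedLoop hq'.1 hstab hdet
  simp only [P.iopClosedLoop_combo q q' hab, smul_eq_mul]
  refine (hν.add_le _ (mem_RHinf_iff.mpr (h.smul_real a)) _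
    (mem_RHinf_iff.mpr (h'.smul_real b))).trans_eq ?_
  rw [hν.smul _ _ (mem_RHinf_iff.mpr h), hν.smul _ _ (mem_RHinf_iff.mpr h'), abs_of_nonneg ha,
    abs_of_nonneg hb]

/-- If some feasible quadruple defines a controller, those which do are dense with respect to
the cost. -/
theorem exists_definesController_lt (hstab : Stabilizable P.A P.B₂) (hdet : Detectable P.A P.C₂)
    {ν : TransferMatrix nz nw → ℝ} (hν : IsSeminormOnRHinf ν) {q q₀ : IOParam nu ny}
    (hq : q ∈ P.iopFeasible L) (hq₀ : q₀ ∈ P.iopFeasible L) (h₀ : IOParam.DefinesController q₀)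
    {c : ℝ} (hc : ν (P.iopClosedLoop q) < c) :
    ∃ q' ∈ P.iopFeasible L, IOParam.DefinesController q' ∧ ν (P.iopClosedLoop q') < c := by
  obtain ⟨D, hD⟩ := P.hasFeedthrough_Y hq.1
  obtain ⟨D₀, hD₀⟩ := P.hasFeedthrough_Y hq₀.1
  have hev : ∀ᶠ t : ℝ in 𝓝[>] 0, IsUnit ((1 - t) • D + t • D₀) :=
    (eventually_isUnit_combo (P.isUnit_of_definesController hq₀.1 h₀ hD₀)).filter_mono
      (nhdsWithin_mono _ fun t (ht : 0 < t) => ht.ne')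
  have hlim : Filter.Tendsto (fun t : ℝ => (1 - t) * ν (P.iopClosedLoop q) +
      t * ν (P.iopClosedLoop q₀)) (𝓝[>] 0) (𝓝 (ν (P.iopClosedLoop q))) := by
    have : Continuous fun t : ℝ => (1 - t) * ν (P.iopClosedLoop q) +
      t * ν (P.iopClosedLoop q₀) := by fun_prop
    have h := (this.tendsto 0).mono_left (nhdsWithin_le_nhds (s := Set.Ioi 0))
    simpa using h
  -- A small step from `q` towards `q₀` keeps the convex cost bound below `c` and makes `Y`
  -- invertible at infinity.
  obtain ⟨t, ht, htc, ht01⟩ := (hev.and ((hlim.eventually_lt_const hc).and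
    (Ioo_mem_nhdsGT one_pos))).exists
  have hab : (1 - t) + t = 1 := sub_add_cancel 1 t
  have hmem := P.convex_iopFeasible hq hq₀ (sub_nonneg.mpr ht01.2.le) ht01.1.le hab
  refine ⟨_, hmem, P.definesController_of_isUnit hmem.1 ((hD.smul (1 - t)).add (hD₀.smul t)) ht, ?_⟩
  exact ((P.convexOn_iopClosedLoop hstab hdet hν).2 hq hq₀ (sub_nonneg.mpr ht01.2.le) ht01.1.le
    hab).trans_lt htc

end Plant

end

/-! ### Assembly of the correspondence and of the equivalence of the two problems. -/

theorem corollary1 {n nw nu nz ny : ℕ} (P : Plant n nw nu nz ny)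
    (hstab : Stabilizable P.A P.B₂) (hdet : Detectable P.A P.C₂)
    (L : Submodule ℝ (TransferMatrix nu ny)) (hclosed : IsResponseClosed L)
    (hQI : QuadraticallyInvariant L P.P₂₂) :
    -- the structured stabilizing controllers are the `U Y⁻¹` with `U ∈ L`
    (P.Cstab ∩ (L : Set (TransferMatrix nu ny)) =
      {K | ∃ q ∈ P.iopFeasible L, IOParam.DefinesController q ∧ K = IOParam.controller q}) ∧
    -- for a strictly proper `P₂₂` every feasible quadruple defines a controller
    (P.D₂₂ = 0 → ∀ q ∈ P.iopFeasible L, IOParam.DefinesController q) ∧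
    -- the closed-loop maps lie in `RH∞`, and the change of variables is one-to-one, onto, and
    -- preserves them
    (∀ q ∈ P.iopFeasible L, P.iopClosedLoop q ∈ RHinf nz nw) ∧
    Set.BijOn IOParam.controller {q ∈ P.iopFeasible L | IOParam.DefinesController q}
      (P.Cstab ∩ (L : Set (TransferMatrix nu ny))) ∧
    (∀ q ∈ P.iopFeasible L, IOParam.DefinesController q →
      P.closedLoop (IOParam.controller q) = P.iopClosedLoop q) ∧
    -- the input-output problem is convex and equivalent to the controller problem
    ∀ ν : TransferMatrix nz nw → ℝ, IsSeminormOnRHinf ν →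
      Convex ℝ (P.iopFeasible L) ∧
      ConvexOn ℝ (P.iopFeasible L) (fun q => ν (P.iopClosedLoop q)) ∧
      (P.D₂₂ = 0 ∨ (P.Cstab ∩ (L : Set (TransferMatrix nu ny))).Nonempty →
        (⨅ K ∈ P.Cstab ∩ (L : Set (TransferMatrix nu ny)), ((ν (P.closedLoop K) : ℝ) : EReal)) =
          ⨅ q ∈ P.iopFeasible L, ((ν (P.iopClosedLoop q) : ℝ) : EReal)) ∧
      (∀ K : TransferMatrix nu ny,
        (K ∈ P.Cstab ∩ (L : Set (TransferMatrix nu ny)) ∧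
          IsMinOn (fun K' => ν (P.closedLoop K'))
            (P.Cstab ∩ (L : Set (TransferMatrix nu ny))) K) ↔
        ∃ q ∈ P.iopFeasible L, IOParam.DefinesController q ∧ K = IOParam.controller q ∧
          IsMinOn (fun q' => ν (P.iopClosedLoop q')) (P.iopFeasible L) q) := by
  have hto : ∀ q ∈ P.iopFeasible L, IOParam.DefinesController q →
      IOParam.controller q ∈ P.Cstab ∩ (L : Set (TransferMatrix nu ny)) := fun q hq h =>
    ⟨P.controller_mem_Cstab hq.1 hstab hdet h, P.controller_mem hq hclosed hQI h⟩
  have hfrom : ∀ K ∈ P.Cstab ∩ (L : Set (TransferMatrix nu ny)),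
      ∃ q ∈ P.iopFeasible L, IOParam.DefinesController q ∧ K = IOParam.controller q :=
    fun K hK => P.exists_mem_iopFeasible hK.1 hK.2 hclosed hQI
  have hcl : ∀ q ∈ P.iopFeasible L, IOParam.DefinesController q →
      P.closedLoop (IOParam.controller q) = P.iopClosedLoop q :=
    fun q hq h => P.closedLoop_controller hq.1 h
  refine ⟨?_, fun h0 q hq => P.definesController_of_strictlyProper hq.1 h0,
    fun q hq => mem_RHinf_iff.mpr (P.entriesIn_iopClosedLoop hq.1 hstab hdet), ⟨?_, ?_, ?_⟩, hcl,
    fun ν hν => ⟨P.convex_iopFeasible, P.convexOn_iopClosedLoop hstab hdet hν, ?_, ?_⟩⟩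
  · ext K
    refine ⟨hfrom K, ?_⟩
    rintro ⟨q, hq, h, rfl⟩
    exact hto q hq h
  · exact fun q hq => hto q hq.1 hq.2
  · exact fun q hq q' hq' he => P.eq_of_controller_eq hq.1.1 hq'.1.1 hq.2 hq'.2 he
  · intro K hK
    obtain ⟨q, hq, h, rfl⟩ := hfrom K hK
    exact ⟨q, ⟨hq, h⟩, rfl⟩
  · intro hcase
    apply le_antisymm
    · refine le_iInf₂ fun q hq => ?_
      -- Either case provides an element that defines a controller, from which the density argument
      -- starts.
      obtain ⟨q₀, hq₀, h₀⟩ : ∃ q₀ ∈ P.iopFeasible L, IOParam.DefinesController q₀ := by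
        rcases hcase with h0 | ⟨K, hK⟩
        · exact ⟨q, hq, P.definesController_of_strictlyProper hq.1 h0⟩
        · obtain ⟨q₀, hq₀, h₀, -⟩ := hfrom K hK
          exact ⟨q₀, hq₀, h₀⟩
      by_contra hlt
      obtain ⟨c, hc, hc'⟩ := EReal.lt_iff_exists_real_btwn.mp (not_le.mp hlt)
      obtain ⟨q', hq', h', hlt'⟩ := P.exists_definesController_lt hstab hdet hν hq hq₀ h₀
        (EReal.coe_lt_coe_iff.mp hc)
      refine absurd (hc'.trans_le (iInf₂_le _ (hto q' hq' h'))) (not_lt.mpr ?_)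
      rw [hcl q' hq' h']
      exact EReal.coe_le_coe_iff.mpr hlt'.le
    · refine le_iInf₂ fun K hK => ?_
      obtain ⟨q, hq, h, rfl⟩ := hfrom K hK
      rw [hcl q hq h]
      exact iInf₂_le q hq
  · intro K
    constructor
    · rintro ⟨hK, hmin⟩
      obtain ⟨q, hq, h, rfl⟩ := hfrom K hK
      refine ⟨q, hq, h, rfl, isMinOn_iff.mpr fun q₁ hq₁ => ?_⟩
      by_contra hlt
      -- A better `q₁` need not define a controller, but a perturbation of it towards `q` does and
      -- still beats the minimum.
      obtain ⟨q', hq', h', hlt'⟩ := P.exists_definesController_lt hstab hdet hν hq₁ hq h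
        (not_le.mp hlt)
      have := isMinOn_iff.mp hmin _ (hto q' hq' h')
      rw [hcl q hq h, hcl q' hq' h'] at this
      exact absurd hlt' (not_lt.mpr this)
    · rintro ⟨q, hq, h, rfl, hmin⟩
      refine ⟨hto q hq h, isMinOn_iff.mpr fun K hK => ?_⟩
      obtain ⟨q', hq', h', rfl⟩ := hfrom K hK
      rw [hcl q hq h, hcl q' hq' h']
      exact isMinOn_iff.mp hmin q' hq'
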